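/- **Model.** $M$ antennas are partitioned into $G$ groups; group $i$ has $M_i$ antennas and sends pilots $\mathbf P_i\in\mathbb C^{M_i\times L_i}$. Let $\mathbf f\in\mathbb C^M$ have sub-vectors $\mathbf f_i\in\mathbb C^{M_i}$, put $\mathbf F_i=\mathrm{diag}(\mathbf f_i)$, and let $\mathbf h$ collect $\mathrm{vec}(\mathbf H_{i\to j})$, $\mathbf H_{i\to j}\in\mathbb C^{M_j\times M_i}$, over all pairs $i<j$. Let $*$ be the Khatri–Rao (column-wise Kronecker) product. The matrix $\mathcal H=\mathcal H(\mathbf h,\mathbf P)$ has, for each pair $i<j$, a block row equal to $\mathbf P_i^T*\mathbf H_{i\to j}$ in the columns of group $i$ (zero elsewhere) and a block row equal to $\mathbf H_{i\to j}^T*\mathbf P_j^T$ in the columns of group $j$ (zero elsewhere). The matrix $\mathcal F=\mathcal F(\mathbf f,\mathbf P)$ is block diagonal with one block $\begin{bmatrix}\mathbf P_i^T\mathbf F_i\otimes\mathbf I\\ \mathbf I\otimes\mathbf P_j^T\mathbf F_j\end{bmatrix}$ for each pair $i<j$. Then $\mathcal H\mathbf f=\mathcal F\mathbf h$, and one observes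 $\mathbf y=\mathcal H\mathbf f+\mathbf n=\mathcal F\mathbf h+\mathbf n$ with $\mathbf n\sim\mathcal{CN}(0,\sigma^2\mathbf I)$, $\sigma>0$. Both $\mathbf f$ and $\mathbf h$ are deterministic and unknown, and $\mathbf h$ is a nuisance parameter. **Notation.** $\dagger$ is the Moore–Penrose inverse, $\mathcal P_{\mathbf X}=\mathbf X(\mathbf X^H\mathbf X)^\dagger\mathbf X^H$, $\mathcal P_{\mathbf X}^\perp=\mathbf I-\mathcal P_{\mathbf X}$, $\mathbf K=\mathcal H^H\mathcal P_{\mathcal F}^\perp\mathcal H$. For $\theta=(\mathbf f,\mathbf h)$, the complex Fisher information matrix is $\mathbf J=\mathbb E[\mathbf s\mathbf s^H]$, where $\mathbf s=\partial\ln p(\mathbf y;\theta)/\partial\theta^*$ (Wirtinger gradient). Let $C:\mathbb C^M\to\mathbb C$ be real-differentiable at $\mathbf f$ (it may depend on the true $\mathbf f$), and impose the constraint $C(\hat{\mathbf f})=0$. Let $\mathbf q$ be the Wirtinger gradient of $(\mathbf f,\mathbf h)\mapsto C(\mathbf f)$ with respect to $\theta^*$. The constrained Cramér–Rao bound $\mathrm{CRB}_{\mathbf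 f}$ is the $(\mathbf f,\mathbf f)$ block of $(\mathcal P_{\mathbf q}^\perp\mathbf J\mathcal P_{\mathbf q}^\perp)^\dagger=\mathbf U(\mathbf U^H\mathbf J\mathbf U)^\dagger\mathbf U^H$, where the columns of $\mathbf U$ form an orthonormal basis of $\mathbf q^\perp$. Call $C$ *regular* at $\mathbf f$ if $C(\mathbf f)=0$, $C$ is (real) $C^1$ near $\mathbf f$, and the kernel of its real differential at $\mathbf f$ is a complex subspace. Call a matrix $\mathbf B$ a *tight bound* for $C$ if $\mathbf B$ is the least element, in the Loewner order, of the set of error covariances $\mathbb E[(\hat{\mathbf f}-\mathbf f)(\hat{\mathbf f}-\mathbf f)^H]$ of estimators $\hat{\mathbf f}(\mathbf y)$ that have finite second moments at $(\mathbf f,\mathbf h)$ and are unbiased to first order on the constraint set, i.e. $\mathbb E_{\theta'}[\hat{\mathbf f}]-\mathbf f'=o(\|\theta'-\theta\|)$ as $\theta'=(\mathbf f',\mathbf h')\to\theta=(\mathbf f,\mathbf h)$ with $C(\mathbf f')=0$. **Claim.** 0. $\mathbf J=\sigma^{-2}[\mathcal H\ \mathcal F]^H[\mathcal H\ \mathcal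 F]$. 1. Let $\mathbf V_{\mathbf f}$ be an $M\times(M-1)$ matrix with $\mathcal P_{\mathbf V_{\mathbf f}}=\mathcal P^\perp_{\partial C/\partial\mathbf f^*}$, the gradient being taken at $\mathbf f$, such that $\mathbf V_{\mathbf f}^H\mathbf K\mathbf V_{\mathbf f}$ is invertible. Then $$\mathrm{CRB}_{\mathbf f}=\sigma^2\,\mathbf V_{\mathbf f}\left(\mathbf V_{\mathbf f}^H\mathcal H^H\mathcal P_{\mathcal F}^\perp\mathcal H\mathbf V_{\mathbf f}\right)^{-1}\mathbf V_{\mathbf f}^H ,$$ and if $C$ is regular at $\mathbf f$, this matrix is a tight bound for $C$. No invertibility of $\mathcal F^H\mathcal F$ is assumed. 2. Suppose $\mathbf f\ne0$ and the null space of $\mathbf K$ is one-dimensional. Then this null space is $\mathbb C\mathbf f$, and for every $C$ (real-differentiable at $\mathbf f$) whose gradient $\partial C/\partial\mathbf f^*$ at $\mathbf f$ spans $\mathbb C\mathbf f$: for every $M\times(M-1)$ matrix $\mathbf V_{\mathbf f}$ with $\mathcal P_{\mathbf V_{\mathbf f}}=\mathcal P^\perp_{\partial C/\partial\mathbf f^*}$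 the matrix $\mathbf V_{\mathbf f}^H\mathbf K\mathbf V_{\mathbf f}$ is invertible, the expression in 1 equals $\sigma^2\mathbf K^\dagger$, and $$\mathrm{CRB}_{\mathbf f}=\sigma^2\left(\mathcal H^H\mathcal P_{\mathcal F}^\perp\mathcal H\right)^\dagger ;$$ if moreover $C$ is regular at $\mathbf f$, this matrix is a tight bound for $C$. 3. If $\mathbf f\ne0$, both the norm-plus-phase constraint $\mathrm{Re}\,C(\hat{\mathbf f})=\|\hat{\mathbf f}\|^2-\|\mathbf f\|^2$, $\mathrm{Im}\,C(\hat{\mathbf f})=\mathrm{Im}(\hat{\mathbf f}^H\mathbf f)$ and the linear constraint $C(\hat{\mathbf f})=\hat{\mathbf f}^H\mathbf g-c$ with $\mathbf g=\mathbf f$, $c=\|\mathbf f\|^2$ are regular at $\mathbf f$, and their gradients $\partial C/\partial\mathbf f^*$ at $\mathbf f$ span $\mathbb C\mathbf f$; so 2 applies to both. -/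

import Mathlib

open MeasureTheory Matrix Asymptotics Topology
open scoped ComplexConjugate ComplexOrder Kronecker

noncomputable section

/-! ### Moore-Penrose pseudo-inverse and orthogonal projections -/

/-- The four Penrose conditions: `X` is the Moore-Penrose pseudo-inverse of `A`. -/
structure IsMoorePenrose {m n : Type*} [Fintype m] [Fintype n]
    (A : Matrix m n ℂ) (X : Matrix n m ℂ) : Prop where
  mul_mul : A * X * A = A
  mul_mul' : X * A * X = X
  left_herm : (A * X)ᴴ = A * X
  right_herm : (X * A)ᴴ = X * A

theorem IsMoorePenrose.unique {m n : Type*} [Fintype m] [Fintype n]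
    {A : Matrix m n ℂ} {X Y : Matrix n m ℂ}
    (hX : IsMoorePenrose A X) (hY : IsMoorePenrose A Y) : X = Y := by
  have h1 : A * X = A * Y := by
    have e : A * X = (A * Y) * (A * X) := by
      rw [← Matrix.mul_assoc, hY.mul_mul]
    have e' := congrArg conjTranspose e
    rw [conjTranspose_mul (A * Y), hX.left_herm, hY.left_herm] at e'
    rw [e', ← Matrix.mul_assoc, hX.mul_mul]
  have h2 : X * A = Y * A := by
    have e : X * A = (X * A) * (Y * A) := by
      rw [Matrix.mul_assoc X A, ← Matrix.mul_assoc A Y, hY.mul_mul]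
    have e' := congrArg conjTranspose e
    rw [conjTranspose_mul (X * A), hX.right_herm, hY.right_herm] at e'
    rw [e', Matrix.mul_assoc Y A, ← Matrix.mul_assoc A X, hX.mul_mul]
  calc X = X * A * X := hX.mul_mul'.symm
    _ = Y * (A * X) := by rw [h2, Matrix.mul_assoc]
    _ = Y := by rw [h1, ← Matrix.mul_assoc, hY.mul_mul']

theorem exists_isMoorePenrose_of_isHermitian {n : Type*} [Fintype n] [DecidableEq n]
    {A : Matrix n n ℂ} (hA : A.IsHermitian) : ∃ X, IsMoorePenrose A X ∧ Xᴴ = X := by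
  obtain ⟨U, d, hU, hAd⟩ : ∃ (U : Matrix n n ℂ) (d : n → ℝ), Uᴴ * U = 1 ∧
      A = U * diagonal (fun i => (d i : ℂ)) * Uᴴ := by
    refine ⟨hA.eigenvectorUnitary, hA.eigenvalues, ?_, ?_⟩
    · exact (Matrix.mem_unitaryGroup_iff').1 hA.eigenvectorUnitary.2
    · conv_lhs => rw [hA.spectral_theorem]
      rfl
  have key : ∀ a b : n → ℂ, (U * diagonal a * Uᴴ) * (U * diagonal b * Uᴴ) =
      U * diagonal (fun i => a i * b i) * Uᴴ := by
    intro a b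
    calc (U * diagonal a * Uᴴ) * (U * diagonal b * Uᴴ)
        = U * diagonal a * (Uᴴ * U) * diagonal b * Uᴴ := by simp only [Matrix.mul_assoc]
      _ = _ := by rw [hU, Matrix.mul_one, Matrix.mul_assoc U, diagonal_mul_diagonal]
  have herm : ∀ a : n → ℝ, (U * diagonal (fun i => (a i : ℂ)) * Uᴴ)ᴴ =
      U * diagonal (fun i => (a i : ℂ)) * Uᴴ := by
    intro a
    have hs : (star fun i => (a i : ℂ)) = fun i => (a i : ℂ) := by
      ext i; simp
    rw [conjTranspose_mul, conjTranspose_mul, conjTranspose_conjTranspose,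
      diagonal_conjTranspose, hs, Matrix.mul_assoc]
  have hone : ∀ x : ℝ, (x : ℂ) * ((x⁻¹ : ℝ) : ℂ) = ((x * x⁻¹ : ℝ) : ℂ) := by
    intro x; push_cast; rfl
  have hone' : ∀ x : ℝ, ((x⁻¹ : ℝ) : ℂ) * (x : ℂ) = ((x * x⁻¹ : ℝ) : ℂ) := by
    intro x; push_cast; ring
  refine ⟨U * diagonal (fun i => (((d i)⁻¹ : ℝ) : ℂ)) * Uᴴ, ⟨?_, ?_, ?_, ?_⟩, herm _⟩
  · rw [hAd, key, key]
    congr 3; ext i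
    rw [← Complex.ofReal_mul, ← Complex.ofReal_mul]
    congr 1
    exact mul_inv_mul_cancel (d i)
  · rw [hAd, key, key]
    congr 3; ext i
    rw [← Complex.ofReal_mul, ← Complex.ofReal_mul]
    congr 1
    by_cases hd : d i = 0
    · simp [hd]
    · field_simp
  · rw [hAd, key]
    simp only [hone]
    exact herm _
  · rw [hAd, key]
    simp only [hone']
    exact herm _

theorem exists_isMoorePenrose {m n : Type*} [Fintype m] [Fintype n]
    (A : Matrix m n ℂ) : ∃ X, IsMoorePenrose A X := by
  classical
  obtain ⟨Z, hZ, hZh⟩ :=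
    exists_isMoorePenrose_of_isHermitian (Matrix.isHermitian_conjTranspose_mul_self A)
  have h0 : A * (Z * (Aᴴ * A)) = A := by
    have h : Aᴴ * A * (Z * (Aᴴ * A) - 1) = 0 := by
      rw [Matrix.mul_sub, Matrix.mul_one, ← Matrix.mul_assoc, hZ.mul_mul, sub_self]
    rw [Matrix.conjTranspose_mul_self_mul_eq_zero] at h
    rw [Matrix.mul_sub, Matrix.mul_one, sub_eq_zero] at h
    exact h
  refine ⟨Z * Aᴴ, ⟨?_, ?_, ?_, ?_⟩⟩
  · rw [Matrix.mul_assoc, Matrix.mul_assoc]; exact h0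
  · have := hZ.mul_mul'
    calc Z * Aᴴ * A * (Z * Aᴴ) = (Z * (Aᴴ * A) * Z) * Aᴴ := by simp only [Matrix.mul_assoc]
      _ = Z * Aᴴ := by rw [this]
  · rw [conjTranspose_mul, conjTranspose_mul, conjTranspose_conjTranspose, hZh, Matrix.mul_assoc]
  · rw [Matrix.mul_assoc]; exact hZ.right_herm

/-- The Moore-Penrose pseudo-inverse `A†`. -/
def pinv {m n : Type*} [Fintype m] [Fintype n] (A : Matrix m n ℂ) : Matrix n m ℂ :=
  (exists_isMoorePenrose A).choose

theorem pinv_spec {m n : Type*} [Fintype m] [Fintype n] (A : Matrix m n ℂ) :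
    IsMoorePenrose A (pinv A) :=
  (exists_isMoorePenrose A).choose_spec

/-- `P_X = X (Xᴴ X)† Xᴴ`, the orthogonal projection onto the column space of `X`. -/
def colProj {m n : Type*} [Fintype m] [Fintype n] (X : Matrix m n ℂ) : Matrix m m ℂ :=
  X * pinv (Xᴴ * X) * Xᴴ

/-- `P_X^⊥ = I - P_X`. -/
def colProjPerp {m n : Type*} [Fintype m] [DecidableEq m] [Fintype n] (X : Matrix m n ℂ) :
    Matrix m m ℂ :=
  1 - colProj X

/-! ### Complex Fisher information and constrained Cramér-Rao bound -/

/-- The Wirtinger gradient `∂φ/∂x*`, with entries `(∂φ/∂(Re xₖ) + i ∂φ/∂(Im xₖ)) / 2`. -/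
def wirtingerConj {n : Type*} [Fintype n] [DecidableEq n] (φ : (n → ℂ) → ℂ) (x : n → ℂ) :
    n → ℂ :=
  fun k => (1 / 2) * (fderiv ℝ φ x (Pi.single k 1) +
    Complex.I * fderiv ℝ φ x (Pi.single k Complex.I))

/-- The law with density `p θ` with respect to `ν`. -/
def modelLaw {n Y : Type*} [MeasurableSpace Y] (ν : Measure Y) (p : (n → ℂ) → Y → ℝ)
    (θ : n → ℂ) : Measure Y :=
  ν.withDensity (fun y => ENNReal.ofReal (p θ y))

/-- The complex score `s(y) = ∂ ln p(y; θ) / ∂θ*`. -/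
def score {n Y : Type*} [Fintype n] [DecidableEq n] (p : (n → ℂ) → Y → ℝ) (θ : n → ℂ) (y : Y) :
    n → ℂ :=
  wirtingerConj (fun θ' => ((Real.log (p θ' y) : ℝ) : ℂ)) θ

/-- The complex Fisher information matrix `J = E_θ[s sᴴ]`. -/
def fisherMatrix {n Y : Type*} [Fintype n] [DecidableEq n] [MeasurableSpace Y] (ν : Measure Y)
    (p : (n → ℂ) → Y → ℝ) (θ : n → ℂ) : Matrix n n ℂ :=
  Matrix.of fun k l => ∫ y, score p θ y k * conj (score p θ y l) ∂(modelLaw ν p θ)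

/-- The Cramér-Rao bound for the whole parameter vector with Fisher information `J`, under one
complex constraint with gradient `q = ∂c/∂θ*`: the pseudo-inverse of the Fisher information
compressed to the orthogonal complement of `q`. For a matrix `U` whose columns form an orthonormal
basis of that complement, this is `U (Uᴴ J U)† Uᴴ`. -/
def constrainedCRB {n : Type*} [Fintype n] [DecidableEq n] (J : Matrix n n ℂ) (q : n → ℂ) :
    Matrix n n ℂ :=
  pinv (colProjPerp (replicateCol Unit q) * J * colProjPerp (replicateCol Unit q))

/-! ### Circular complex Gaussian noise -/

/-- Density of `CN(μ, σ² I)` with respect to Lebesgue measure. -/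
def cgaussianPDF {ι : Type*} [Fintype ι] (σ : ℝ) (μ y : ι → ℂ) : ℝ :=
  ((Real.pi * σ ^ 2) ^ Fintype.card ι)⁻¹ * Real.exp (-(∑ k, ‖y k - μ k‖ ^ 2) / σ ^ 2)

/-! ### The bilinear calibration model -/

/-- The antennas `0, …, M - 1` are partitioned into `G` groups by `grp`; `AntGroup grp i` is the
`i`-th group. -/
abbrev AntGroup {M G : ℕ} (grp : Fin M → Fin G) (i : Fin G) : Type := {a : Fin M // grp a = i}

/-- Pairs of groups `i < j`. -/
abbrev GroupPair (G : ℕ) : Type := {p : Fin G × Fin G // p.1 < p.2}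

/-- Index set of the observation `y`: for each pair `i < j`, the entries of `vec(Y_{i→j})` and of
`vec(Y_{j→i}ᵀ)` (the first component is the column of the matrix, the second one its row). -/
abbrev ObsIdx {M G : ℕ} (grp : Fin M → Fin G) (L : Fin G → ℕ) : Type :=
  Σ p : GroupPair G, (Fin (L p.1.1) × AntGroup grp p.1.2) ⊕ (AntGroup grp p.1.1 × Fin (L p.1.2))

/-- Index set of the auxiliary channel `h`: for each pair `i < j`, the entries of `vec(H_{i→j})`. -/
abbrev ChanIdx {M G : ℕ} (grp : Fin M → Fin G) : Type :=
  Σ p : GroupPair G, AntGroup grp p.1.1 × AntGroup grp p.1.2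

/-- Khatri-Rao (column-wise Kronecker) product. -/
def khatriRao {m₁ m₂ n : Type*} (A : Matrix m₁ n ℂ) (B : Matrix m₂ n ℂ) :
    Matrix (m₁ × m₂) n ℂ :=
  Matrix.of fun r k => A r.1 k * B r.2 k

/-- Places the columns of `B` at the positions of group `i`; all other columns are zero. -/
def atGroup {M G : ℕ} {grp : Fin M → Fin G} {R : Type*} (i : Fin G)
    (B : Matrix R (AntGroup grp i) ℂ) : Matrix R (Fin M) ℂ :=
  Matrix.of fun r a => if ha : grp a = i then B r ⟨a, ha⟩ else 0

/-- The auxiliary channel matrix `H_{i→j}` (of size `M_j × M_i`) stored in the vector `h`. -/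
def chanMat {M G : ℕ} {grp : Fin M → Fin G} (h : ChanIdx grp → ℂ) (p : GroupPair G) :
    Matrix (AntGroup grp p.1.2) (AntGroup grp p.1.1) ℂ :=
  Matrix.of fun b a => h ⟨p, (a, b)⟩

/-- The composite matrix `𝓗(h, P)`: the block row of `Y_{i→j}` is `P_iᵀ * H_{i→j}` in the columns of
group `i`, and the block row of `Y_{j→i}ᵀ` is `H_{i→j}ᵀ * P_jᵀ` in the columns of group `j`
(`*` is the Khatri-Rao product). -/
def calH {M G : ℕ} {grp : Fin M → Fin G} {L : Fin G → ℕ}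
    (P : ∀ i, Matrix (AntGroup grp i) (Fin (L i)) ℂ) (h : ChanIdx grp → ℂ) :
    Matrix (ObsIdx grp L) (Fin M) ℂ :=
  Matrix.of fun r a =>
    Matrix.fromRows
      (atGroup r.1.1.1 (khatriRao (P r.1.1.1)ᵀ (chanMat h r.1)))
      (atGroup r.1.1.2 (khatriRao (chanMat h r.1)ᵀ (P r.1.1.2)ᵀ)) r.2 a

/-- The diagonal calibration matrix `F_i = diag(f_i)` of group `i`. -/
def calDiag {M G : ℕ} (grp : Fin M → Fin G) (f : Fin M → ℂ) (i : Fin G) :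
    Matrix (AntGroup grp i) (AntGroup grp i) ℂ :=
  diagonal fun a => f a.1

/-- The composite matrix `𝓕(f, P)`: block diagonal, with block
`[P_iᵀ F_i ⊗ I ; I ⊗ P_jᵀ F_j]` for each pair `i < j`. -/
def calF {M G : ℕ} {grp : Fin M → Fin G} {L : Fin G → ℕ}
    (P : ∀ i, Matrix (AntGroup grp i) (Fin (L i)) ℂ) (f : Fin M → ℂ) :
    Matrix (ObsIdx grp L) (ChanIdx grp) ℂ :=
  Matrix.blockDiagonal' fun p : GroupPair G =>
    Matrix.fromRows
      (((P p.1.1)ᵀ * calDiag grp f p.1.1) ⊗ₖ (1 : Matrix (AntGroup grp p.1.2) (AntGroup grp p.1.2) ℂ))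
      ((1 : Matrix (AntGroup grp p.1.1) (AntGroup grp p.1.1) ℂ) ⊗ₖ ((P p.1.2)ᵀ * calDiag grp f p.1.2))

/-- Likelihood of the joint parameter `θ = (f, h)` for `y = 𝓗(h, P) f + n`, `n ∼ CN(0, σ² I)`. -/
def calLik {M G : ℕ} {grp : Fin M → Fin G} {L : Fin G → ℕ} (σ : ℝ)
    (P : ∀ i, Matrix (AntGroup grp i) (Fin (L i)) ℂ) (θ : Fin M ⊕ ChanIdx grp → ℂ)
    (y : ObsIdx grp L → ℂ) : ℝ :=
  cgaussianPDF σ (calH P (θ ∘ Sum.inr) *ᵥ (θ ∘ Sum.inl)) y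

/-- Complex Fisher information matrix for jointly estimating `f` and `h`. -/
def calFIM {M G : ℕ} {grp : Fin M → Fin G} {L : Fin G → ℕ} (σ : ℝ)
    (P : ∀ i, Matrix (AntGroup grp i) (Fin (L i)) ℂ) (f : Fin M → ℂ) (h : ChanIdx grp → ℂ) :
    Matrix (Fin M ⊕ ChanIdx grp) (Fin M ⊕ ChanIdx grp) ℂ :=
  fisherMatrix (volume : Measure (ObsIdx grp L → ℂ)) (calLik σ P) (Sum.elim f h)

/-- The constrained Cramér-Rao bound for `f`, with nuisance parameter `h`, under the constraint
`C(f̂) = 0`: the `(f, f)` block of the constrained Cramér-Rao bound for `(f, h)`. (`C` is the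
function `f̂ ↦ C(f̂, f)`; it may depend on the true `f`.) -/
def calCRB {M G : ℕ} {grp : Fin M → Fin G} {L : Fin G → ℕ} (σ : ℝ)
    (P : ∀ i, Matrix (AntGroup grp i) (Fin (L i)) ℂ) (f : Fin M → ℂ) (h : ChanIdx grp → ℂ)
    (C : (Fin M → ℂ) → ℂ) : Matrix (Fin M) (Fin M) ℂ :=
  (constrainedCRB (calFIM σ P f h)
    (wirtingerConj (fun θ : Fin M ⊕ ChanIdx grp → ℂ => C (θ ∘ Sum.inl)) (Sum.elim f h))).toBlocks₁₁

/-- The matrix `𝓗ᴴ P_𝓕^⊥ 𝓗`. -/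
def calGram {M G : ℕ} {grp : Fin M → Fin G} {L : Fin G → ℕ}
    (P : ∀ i, Matrix (AntGroup grp i) (Fin (L i)) ℂ) (f : Fin M → ℂ) (h : ChanIdx grp → ℂ) :
    Matrix (Fin M) (Fin M) ℂ :=
  (calH P h)ᴴ * colProjPerp (calF P f) * calH P h

/-! ### Constraints -/

/-- Norm plus phase constraint: `Re C = ‖f̂‖² - ‖f‖²`, `Im C = Im (f̂ᴴ f)`. -/
def normPhaseConstraint {M : ℕ} (f fh : Fin M → ℂ) : ℂ :=
  ⟨(∑ k, ‖fh k‖ ^ 2) - ∑ k, ‖f k‖ ^ 2, (star fh ⬝ᵥ f).im⟩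

/-- Linear constraint `C = f̂ᴴ g - c`. -/
def linearConstraint {M : ℕ} (g : Fin M → ℂ) (c : ℂ) (fh : Fin M → ℂ) : ℂ :=
  star fh ⬝ᵥ g - c

/-- `C = 0` is a regular constraint at `f`: it holds at `f`, it is continuously differentiable (in
the real sense) near `f`, and the directions tangent to it at `f` form a complex subspace, so that
the two real constraints amount to one complex one. -/
structure RegularConstraint {M : ℕ} (C : (Fin M → ℂ) → ℂ) (f : Fin M → ℂ) : Prop where
  zero : C f = 0
  contDiffAt : ContDiffAt ℝ 1 C f
  tangent_complex : ∀ v, fderiv ℝ C f v = 0 → fderiv ℝ C f (Complex.I • v) = 0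

/-! ### Estimators -/

/-- The estimator `est` of `f` has finite second moments at `(f, h)` and is, to first order at
`(f, h)`, unbiased on the constraint set: `E_{θ'}[est] - f' = o(‖θ' - θ‖)` as `θ' = (f', h')` tends
to `θ = (f, h)` subject to `C(f') = 0`. Every estimator with finite second moments that is unbiased
on the constraint set has this property. -/
structure LocallyUnbiased {M G : ℕ} {grp : Fin M → Fin G} {L : Fin G → ℕ} (σ : ℝ)
    (P : ∀ i, Matrix (AntGroup grp i) (Fin (L i)) ℂ) (f : Fin M → ℂ) (h : ChanIdx grp → ℂ)
    (C : (Fin M → ℂ) → ℂ) (est : (ObsIdx grp L → ℂ) → Fin M → ℂ) : Prop where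
  memLp : ∀ k, MemLp (fun y => est y k) 2 (modelLaw volume (calLik σ P) (Sum.elim f h))
  unbiased :
    (fun θ' : Fin M ⊕ ChanIdx grp → ℂ =>
        (fun k => ∫ y, est y k ∂(modelLaw volume (calLik σ P) θ')) - θ' ∘ Sum.inl)
      =o[𝓝[{θ' | C (θ' ∘ Sum.inl) = 0}] (Sum.elim f h)] fun θ' => θ' - Sum.elim f h

/-- The error covariance matrix `E[(est - f)(est - f)ᴴ]` under the true parameters. -/
def errorCov {M G : ℕ} {grp : Fin M → Fin G} {L : Fin G → ℕ} (σ : ℝ)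
    (P : ∀ i, Matrix (AntGroup grp i) (Fin (L i)) ℂ) (f : Fin M → ℂ) (h : ChanIdx grp → ℂ)
    (est : (ObsIdx grp L → ℂ) → Fin M → ℂ) : Matrix (Fin M) (Fin M) ℂ :=
  Matrix.of fun k l =>
    ∫ y, (est y k - f k) * conj (est y l - f l) ∂(modelLaw volume (calLik σ P) (Sum.elim f h))

/-- `B` is the smallest error covariance matrix, in the Loewner order, of the estimators of `f` that
are unbiased to first order on the constraint set `C = 0`; in particular it is a lower bound. -/
def IsTightBound {M G : ℕ} {grp : Fin M → Fin G} {L : Fin G → ℕ} (σ : ℝ)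
    (P : ∀ i, Matrix (AntGroup grp i) (Fin (L i)) ℂ) (f : Fin M → ℂ) (h : ChanIdx grp → ℂ)
    (C : (Fin M → ℂ) → ℂ) (B : Matrix (Fin M) (Fin M) ℂ) : Prop :=
  (∀ est, LocallyUnbiased σ P f h C est → (errorCov σ P f h est - B).PosSemidef) ∧
    ∃ est, LocallyUnbiased σ P f h C est ∧ errorCov σ P f h est = B

end

/-! ### Pseudo-inverses and projections -/

section LinearAlgebra

variable {m n : Type*} [Fintype m] [Fintype n]

/-! The mean of `y` is bilinear in θ = (f, h) with Jacobian A = [𝓗 𝓕], and the score is σ⁻²Aᴴ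
applied to the noise n, so J = σ⁻²AᴴA. The constraint does not involve h, hence the projection off q
is diag(Q, I), where Q is the projection off ∂C/∂f*. Everything is expressed through one Hermitian
matrix W with WQ = W and WKQ = Q, the inverse of K compressed to the range of Q. Block elimination
with W in place of the inverse Schur complement puts W in the (f, f) corner
(`pinv_compressed_gram`); 𝓕 enters only through pseudo-inverses, so it may be rank deficient.

Tightness, for a nonzero gradient: regularity identifies the tangent space of the constraint set
with the orthogonal complement of ∂C/∂f* (`RegularConstraint.ker_and_range`), and each tangent
vector is the velocity of a curve in the set. Differentiating the unbiasedness condition along v and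
iv shows that every admissible estimator has correlation σ²v_f with the noise form (Av)ᴴn
(`LocallyUnbiased.integral_mul_conj`). The estimator is only square integrable, so this rests on an
L² expansion of the Gaussian likelihood ratio (`hasFDerivAt_integral_cgaussLaw`). The error Tn of
`optimalEst`, T = W𝓗ᴴP_𝓕^⊥, is made of such forms, with the columns of W as f-parts. Every
admissible error therefore has cross-covariance σ²W with Tn, which is also the covariance of Tn;
what remains after subtraction is a second moment matrix, hence positive semidefinite. `optimalEst`
is itself admissible because T𝓕 = 0 and T𝓗Q = Q.

When the kernel of K is a line, 𝓗f = 𝓕h forces it to be ℂf. If the gradient spans ℂf, then K†K = Q,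
so K† solves the equations for W, and these have only one solution. -/

theorem IsMoorePenrose.pinv_eq {A : Matrix m n ℂ} {X : Matrix n m ℂ} (h : IsMoorePenrose A X) :
    pinv A = X :=
  (pinv_spec A).unique h

theorem IsMoorePenrose.conjTranspose {A : Matrix m n ℂ} {X : Matrix n m ℂ}
    (h : IsMoorePenrose A X) : IsMoorePenrose Aᴴ Xᴴ where
  mul_mul := by
    rw [← conjTranspose_mul, ← conjTranspose_mul, ← Matrix.mul_assoc, h.mul_mul]
  mul_mul' := by
    rw [← conjTranspose_mul, ← conjTranspose_mul, ← Matrix.mul_assoc, h.mul_mul']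
  left_herm := by rw [← conjTranspose_mul, h.right_herm, h.right_herm]
  right_herm := by rw [← conjTranspose_mul, h.left_herm, h.left_herm]

theorem pinv_conjTranspose (A : Matrix m n ℂ) : pinv Aᴴ = (pinv A)ᴴ :=
  (pinv_spec A).conjTranspose.pinv_eq

theorem pinv_smul {c : ℝ} (hc : c ≠ 0) (A : Matrix m n ℂ) :
    pinv ((c : ℂ) • A) = ((c⁻¹ : ℝ) : ℂ) • pinv A := by
  have hc' : (c : ℂ) ≠ 0 := by exact_mod_cast hc
  refine IsMoorePenrose.pinv_eq ⟨?_, ?_, ?_, ?_⟩ <;>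
    simp only [Complex.ofReal_inv, smul_smul, Matrix.smul_mul, Matrix.mul_smul,
      mul_inv_cancel₀ hc', inv_mul_cancel₀ hc', one_smul, (pinv_spec A).mul_mul,
      (pinv_spec A).mul_mul', (pinv_spec A).left_herm, (pinv_spec A).right_herm]

theorem conjTranspose_pinv_gram (X : Matrix m n ℂ) : (pinv (Xᴴ * X))ᴴ = pinv (Xᴴ * X) := by
  rw [← pinv_conjTranspose, conjTranspose_mul, conjTranspose_conjTranspose]

theorem colProj_mul (X : Matrix m n ℂ) : colProj X * X = X := by
  classical
  -- A Gram matrix has the same kernel as `X`, so the factor `Xᴴ` can be cancelled.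
  have h : Xᴴ * X * (pinv (Xᴴ * X) * (Xᴴ * X) - 1) = 0 := by
    rw [Matrix.mul_sub, Matrix.mul_one, ← Matrix.mul_assoc, (pinv_spec _).mul_mul, sub_self]
  rw [Matrix.conjTranspose_mul_self_mul_eq_zero, Matrix.mul_sub, Matrix.mul_one, sub_eq_zero] at h
  simpa only [colProj, Matrix.mul_assoc] using h

theorem colProj_conjTranspose (X : Matrix m n ℂ) : (colProj X)ᴴ = colProj X := by
  rw [colProj, conjTranspose_mul, conjTranspose_mul, conjTranspose_conjTranspose,
    conjTranspose_pinv_gram, Matrix.mul_assoc]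

theorem conjTranspose_mul_colProj (X : Matrix m n ℂ) : Xᴴ * colProj X = Xᴴ := by
  have := congrArg Matrix.conjTranspose (colProj_mul X)
  rwa [conjTranspose_mul, colProj_conjTranspose] at this

/-- Yields `colProj X = X * pinv X`, which makes the projection factor visibly through the columns
of `X`. -/
theorem pinv_eq_gram (X : Matrix m n ℂ) : pinv X = pinv (Xᴴ * X) * Xᴴ := by
  have h := pinv_spec (Xᴴ * X)
  refine IsMoorePenrose.pinv_eq ⟨?_, ?_, ?_, ?_⟩
  · rw [← Matrix.mul_assoc]; exact colProj_mul X
  · calc pinv (Xᴴ * X) * Xᴴ * X * (pinv (Xᴴ * X) * Xᴴ)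
        = (pinv (Xᴴ * X) * (Xᴴ * X) * pinv (Xᴴ * X)) * Xᴴ := by simp only [Matrix.mul_assoc]
      _ = _ := by rw [h.mul_mul']
  · rw [← Matrix.mul_assoc]; exact colProj_conjTranspose X
  · rw [Matrix.mul_assoc]; exact h.right_herm

theorem mul_pinv (X : Matrix m n ℂ) : X * pinv X = colProj X := by
  rw [pinv_eq_gram, ← Matrix.mul_assoc, colProj]

theorem colProj_mul_colProj (X : Matrix m n ℂ) : colProj X * colProj X = colProj X := by
  conv_lhs => rw [← mul_pinv X, ← Matrix.mul_assoc, mul_pinv, colProj_mul, mul_pinv]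

/-- A Hermitian matrix that fixes the columns of `X` and has its columns in the column space of `X`
is the orthogonal projection onto that space. -/
theorem eq_colProj {X : Matrix m n ℂ} {Q : Matrix m m ℂ} {Y : Matrix n m ℂ} (hQ : Qᴴ = Q)
    (hX : Q * X = X) (hY : Q = X * Y) : Q = colProj X := by
  have h1 : colProj X * Q = Q := by rw [hY, ← Matrix.mul_assoc, colProj_mul]
  have h2 : Q * colProj X = colProj X := by
    rw [colProj, ← Matrix.mul_assoc, ← Matrix.mul_assoc, hX]
  calc Q = (colProj X * Q)ᴴ := by rw [h1, hQ]
    _ = colProj X := by rw [conjTranspose_mul, hQ, colProj_conjTranspose, h2]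

/-- The generalized inverse built from a matrix `V` whose columns span the range of `Q`. -/
theorem compressed_inverse_spec [DecidableEq n] {V : Matrix m n ℂ} {K : Matrix m m ℂ}
    (hK : Kᴴ = K) (hU : IsUnit (Vᴴ * K * V)) :
    (V * (Vᴴ * K * V)⁻¹ * Vᴴ)ᴴ = V * (Vᴴ * K * V)⁻¹ * Vᴴ ∧
    V * (Vᴴ * K * V)⁻¹ * Vᴴ * colProj V = V * (Vᴴ * K * V)⁻¹ * Vᴴ ∧
    V * (Vᴴ * K * V)⁻¹ * Vᴴ * K * colProj V = colProj V := by
  have hd : IsUnit (Vᴴ * K * V).det := (Matrix.isUnit_iff_isUnit_det _).1 hU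
  refine ⟨?_, ?_, ?_⟩
  · simp only [conjTranspose_mul, conjTranspose_nonsing_inv, conjTranspose_conjTranspose, hK,
      Matrix.mul_assoc]
  · rw [Matrix.mul_assoc _ Vᴴ, conjTranspose_mul_colProj]
  · calc V * (Vᴴ * K * V)⁻¹ * Vᴴ * K * colProj V
        = V * ((Vᴴ * K * V)⁻¹ * (Vᴴ * K * V)) * pinv V := by
          rw [← mul_pinv]; simp only [Matrix.mul_assoc]
      _ = colProj V := by rw [Matrix.nonsing_inv_mul _ hd, Matrix.mul_one, mul_pinv]

variable [DecidableEq m]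

theorem colProjPerp_conjTranspose (X : Matrix m n ℂ) : (colProjPerp X)ᴴ = colProjPerp X := by
  rw [colProjPerp, conjTranspose_sub, conjTranspose_one, colProj_conjTranspose]

theorem colProjPerp_mul (X : Matrix m n ℂ) : colProjPerp X * X = 0 := by
  rw [colProjPerp, Matrix.sub_mul, colProj_mul, Matrix.one_mul, sub_self]

theorem conjTranspose_mul_colProjPerp (X : Matrix m n ℂ) : Xᴴ * colProjPerp X = 0 := by
  rw [colProjPerp, Matrix.mul_sub, conjTranspose_mul_colProj, Matrix.mul_one, sub_self]

theorem colProjPerp_mul_colProjPerp (X : Matrix m n ℂ) :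
    colProjPerp X * colProjPerp X = colProjPerp X := by
  simp [colProjPerp, Matrix.sub_mul, Matrix.mul_sub, colProj_mul_colProj]

/-- Displays the projected matrix as `A` corrected by a combination of the columns of `X`; the
coefficients `pinv X * A` later become the nuisance part of a tangent direction. -/
theorem colProjPerp_mul_eq {k : Type*} (X : Matrix m n ℂ) (A : Matrix m k ℂ) :
    colProjPerp X * A = A - X * (pinv X * A) := by
  rw [colProjPerp, Matrix.sub_mul, Matrix.one_mul, ← mul_pinv, Matrix.mul_assoc]

/-- Serves for a gradient that vanishes in the nuisance coordinates: the projection leaves those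
coordinates alone. -/
theorem colProjPerp_fromRows_zero {k : Type*} [Fintype k] [DecidableEq k] (X : Matrix m n ℂ) :
    colProjPerp (fromRows X (0 : Matrix k n ℂ)) =
      fromBlocks (colProjPerp X) 0 0 (1 : Matrix k k ℂ) := by
  have h : colProj (fromRows X (0 : Matrix k n ℂ)) = fromBlocks (colProj X) 0 0 0 := by
    rw [colProj, conjTranspose_fromRows_eq_fromCols_conjTranspose, fromCols_mul_fromRows,
      conjTranspose_zero, Matrix.zero_mul, add_zero, fromRows_mul, fromRows_mul_fromCols,
      Matrix.mul_zero, Matrix.zero_mul, Matrix.zero_mul, Matrix.zero_mul, colProj]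
  rw [colProjPerp, h, ← fromBlocks_one, sub_eq_add_neg, fromBlocks_neg, fromBlocks_add,
    colProjPerp]
  simp [sub_eq_add_neg]

/-- The first diagonal block of the pseudo-inverse of the compressed Gram matrix of `[H F]`, where
`W` is the generalized inverse of the Schur complement of `Fᴴ F` relative to the projection `Q`. -/
theorem pinv_compressed_gram {k : Type*} [Fintype k] [DecidableEq n] [DecidableEq k]
    (H : Matrix m n ℂ) (F : Matrix m k ℂ) {Q W : Matrix n n ℂ} (hQ : Qᴴ = Q) (hW : Wᴴ = W)
    (hWQ : W * Q = W) (hQQ : Q * Q = Q) (hKQ : W * (Hᴴ * colProjPerp F * H) * Q = Q) :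
    (pinv (fromBlocks Q 0 0 (1 : Matrix k k ℂ) * ((fromCols H F)ᴴ * fromCols H F) *
      fromBlocks Q 0 0 1)).toBlocks₁₁ = W := by
  have hQW : Q * W = W := by
    have := congrArg Matrix.conjTranspose hWQ
    rwa [conjTranspose_mul, hQ, hW] at this
  have hF := pinv_spec F
  have hQK : Q * Hᴴ * (H - F * (pinv F * H)) * W = Q := by
    have := congrArg Matrix.conjTranspose hKQ
    simp only [conjTranspose_mul, hQ, hW, colProjPerp_conjTranspose,
      conjTranspose_conjTranspose] at this
    simpa only [← colProjPerp_mul_eq, Matrix.mul_assoc] using this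
  have e1 : Q * Hᴴ * H * W = Q + Q * Hᴴ * F * pinv F * H * W := by
    rw [Matrix.mul_sub, Matrix.sub_mul, sub_eq_iff_eq_add] at hQK
    simpa only [Matrix.mul_assoc] using hQK
  have e2 : Fᴴ * F * pinv F = Fᴴ := by
    rw [Matrix.mul_assoc, mul_pinv, conjTranspose_mul_colProj]
  have e3 : F * pinv (Fᴴ * F) = (pinv F)ᴴ := by
    rw [pinv_eq_gram F, conjTranspose_mul, conjTranspose_conjTranspose, conjTranspose_pinv_gram]
  set N := fromBlocks Q 0 0 (1 : Matrix k k ℂ) * ((fromCols H F)ᴴ * fromCols H F) *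
      fromBlocks Q 0 0 1 with hN
  have hN' : N = fromBlocks (Q * Hᴴ * H * Q) (Q * Hᴴ * F) (Fᴴ * H * Q) (Fᴴ * F) := by
    rw [hN, conjTranspose_fromCols_eq_fromRows_conjTranspose, fromRows_mul_fromCols,
      fromBlocks_multiply, fromBlocks_multiply]
    simp only [Matrix.mul_assoc, Matrix.zero_mul, Matrix.mul_zero, Matrix.one_mul, Matrix.mul_one,
      add_zero, zero_add]
  -- The usual block inverse by Schur complement, with `W` for the inverse of the complement, `pinv
  -- F` for (FᴴF)⁻¹Fᴴ and `pinv (Fᴴ * F)` for (FᴴF)⁻¹.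
  set Z := fromBlocks W (-(W * Hᴴ * (pinv F)ᴴ)) (-(pinv F * H * W))
    (pinv F * H * W * Hᴴ * (pinv F)ᴴ + pinv (Fᴴ * F)) with hZ
  have hNh : Nᴴ = N := by
    rw [hN', fromBlocks_conjTranspose]
    simp only [conjTranspose_mul, conjTranspose_conjTranspose, hQ, Matrix.mul_assoc]
  have hZh : Zᴴ = Z := by
    rw [hZ, fromBlocks_conjTranspose]
    simp only [conjTranspose_add, conjTranspose_neg, conjTranspose_mul,
      conjTranspose_conjTranspose, hW, Matrix.mul_assoc, conjTranspose_pinv_gram]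
  have hNZ : N * Z = fromBlocks Q 0 0 (pinv F * F) := by
    have a1 : Q * Hᴴ * H * Q * W = Q + Q * Hᴴ * F * pinv F * H * W := by
      rw [Matrix.mul_assoc _ Q W, hQW, e1]
    have a2 : Fᴴ * H * Q * W = Fᴴ * H * W := by rw [Matrix.mul_assoc _ Q W, hQW]
    rw [hN', hZ, fromBlocks_multiply]
    congr 1
    · rw [a1]; simp only [Matrix.mul_neg, Matrix.mul_assoc]; abel
    · rw [Matrix.mul_neg, Matrix.mul_add, ← Matrix.mul_assoc, ← Matrix.mul_assoc, a1,
        Matrix.mul_assoc (Q * Hᴴ) F (pinv (Fᴴ * F)), e3]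
      simp only [Matrix.add_mul, Matrix.mul_assoc]; abel
    · rw [a2, Matrix.mul_neg, ← Matrix.mul_assoc, ← Matrix.mul_assoc, e2]; abel
    · rw [Matrix.mul_neg, Matrix.mul_add, ← Matrix.mul_assoc, ← Matrix.mul_assoc, a2]
      simp only [← Matrix.mul_assoc]
      rw [e2, Matrix.mul_assoc Fᴴ F, e3, neg_add_cancel_left, ← conjTranspose_mul, hF.right_herm]
  -- `N`, `Z` and their product are all Hermitian, so the two factors commute.
  have hZN : Z * N = fromBlocks Q 0 0 (pinv F * F) := by
    have := congrArg Matrix.conjTranspose hNZ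
    rwa [conjTranspose_mul, hNh, hZh, fromBlocks_conjTranspose, conjTranspose_zero,
      conjTranspose_zero, hQ, hF.right_herm] at this
  have e4 : pinv F * F * Fᴴ = Fᴴ := by
    rw [← hF.right_herm, ← conjTranspose_mul, ← Matrix.mul_assoc, hF.mul_mul]
  have hMP : IsMoorePenrose N Z := by
    refine ⟨?_, ?_, ?_, ?_⟩
    · rw [hNZ, hN', fromBlocks_multiply]
      simp only [Matrix.zero_mul, add_zero, zero_add, ← Matrix.mul_assoc, hQQ, e4]
    · rw [hZN, hZ, fromBlocks_multiply]
      have e5 : pinv F * F * pinv (Fᴴ * F) = pinv (Fᴴ * F) := by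
        rw [pinv_eq_gram F, Matrix.mul_assoc _ Fᴴ F, (pinv_spec _).mul_mul']
      simp only [Matrix.zero_mul, add_zero, zero_add, Matrix.mul_neg, Matrix.mul_add,
        ← Matrix.mul_assoc, hQW, hF.mul_mul', e5,
        neg_zero, add_zero, zero_add]
    · rw [hNZ, fromBlocks_conjTranspose, conjTranspose_zero, conjTranspose_zero, hQ, hF.right_herm]
    · rw [hZN, fromBlocks_conjTranspose, conjTranspose_zero, conjTranspose_zero, hQ, hF.right_herm]
  rw [hMP.pinv_eq, hZ, toBlocks_fromBlocks₁₁]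

end LinearAlgebra

/-! ### Moments of the circular complex Gaussian law -/

section Gaussian

/-- Density of the one-dimensional centred circular Gaussian law. -/
noncomputable def cgauss (σ : ℝ) (z : ℂ) : ℝ := (Real.pi * σ ^ 2)⁻¹ * Real.exp (-‖z‖ ^ 2 / σ ^ 2)

theorem cgauss_nonneg (σ : ℝ) (z : ℂ) : 0 ≤ cgauss σ z := by unfold cgauss; positivity

theorem continuous_cgauss (σ : ℝ) : Continuous (cgauss σ) := by unfold cgauss; fun_prop

theorem cgauss_neg (σ : ℝ) (z : ℂ) : cgauss σ (-z) = cgauss σ z := by simp [cgauss]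

theorem cgauss_I_mul (σ : ℝ) (z : ℂ) : cgauss σ (Complex.I * z) = cgauss σ z := by simp [cgauss]

/-- A single radial Gamma integral supplies both the total mass (`q = 0`) and the second moment (`q
= 2`). -/
theorem integral_norm_rpow_mul_cgauss {σ : ℝ} (hσ : 0 < σ) {q : ℝ} (hq : -2 < q) :
    ∫ z : ℂ, ‖z‖ ^ q * cgauss σ z = (σ ^ 2) ^ (q / 2) * Real.Gamma ((q + 2) / 2) := by
  have h := Complex.integral_rpow_mul_exp_neg_mul_rpow (p := 2) (q := q) (b := (σ ^ 2)⁻¹)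
    (by norm_num) hq (by positivity)
  have e : ∀ z : ℂ, ‖z‖ ^ q * cgauss σ z =
      (Real.pi * σ ^ 2)⁻¹ * (‖z‖ ^ q * Real.exp (-(σ ^ 2)⁻¹ * ‖z‖ ^ (2 : ℝ))) := by
    intro z
    rw [cgauss, Real.rpow_two, show -‖z‖ ^ 2 / σ ^ 2 = -(σ ^ 2)⁻¹ * ‖z‖ ^ 2 by ring]
    ring
  simp_rw [e]
  rw [integral_const_mul, h, Real.inv_rpow (by positivity), ← Real.rpow_neg (by positivity),
    show -(-(q + 2) / 2) = q / 2 + 1 by ring, Real.rpow_add_one (by positivity)]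
  have := Real.pi_pos
  field_simp

theorem integral_cgauss {σ : ℝ} (hσ : 0 < σ) : ∫ z : ℂ, cgauss σ z = 1 := by
  simpa using integral_norm_rpow_mul_cgauss hσ (q := 0) (by norm_num)

theorem integral_norm_sq_mul_cgauss {σ : ℝ} (hσ : 0 < σ) :
    ∫ z : ℂ, ‖z‖ ^ 2 * cgauss σ z = σ ^ 2 := by
  have h := integral_norm_rpow_mul_cgauss hσ (q := 2) (by norm_num)
  have : Real.Gamma ((2 + 2) / 2) = 1 := by norm_num
  rw [this] at h
  simpa using h

theorem integrable_cgauss {σ : ℝ} (hσ : 0 < σ) : Integrable (cgauss σ) :=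
  -- The Bochner integral of a non-integrable function is 0 by convention, so a nonzero value proves
  -- integrability.
  .of_integral_ne_zero (by rw [integral_cgauss hσ]; exact one_ne_zero)

theorem integrable_norm_sq_mul_cgauss {σ : ℝ} (hσ : 0 < σ) :
    Integrable fun z : ℂ => ‖z‖ ^ 2 * cgauss σ z :=
  .of_integral_ne_zero (by rw [integral_norm_sq_mul_cgauss hσ]; positivity)

theorem integrable_cgauss_mul {σ : ℝ} (hσ : 0 < σ) {φ : ℂ → ℂ} (hc : Continuous φ)
    (hφ : ∀ z, ‖φ z‖ ≤ 1 + ‖z‖ ^ 2) : Integrable fun z : ℂ => (cgauss σ z : ℂ) * φ z := by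
  refine ((integrable_cgauss hσ).add (integrable_norm_sq_mul_cgauss hσ)).mono'
    ((Complex.continuous_ofReal.comp (continuous_cgauss σ)).mul hc).aestronglyMeasurable
    (.of_forall fun z => ?_)
  rw [norm_mul, Complex.norm_real, Real.norm_of_nonneg (cgauss_nonneg σ z), Pi.add_apply]
  nlinarith [hφ z, cgauss_nonneg σ z]

theorem integral_cgauss_mul_of_odd {σ : ℝ} {φ : ℂ → ℂ} (hφ : ∀ z, φ (-z) = -φ z) :
    ∫ z : ℂ, (cgauss σ z : ℂ) * φ z = 0 := by
  have h := integral_neg_eq_self (fun z : ℂ => (cgauss σ z : ℂ) * φ z) volume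
  simp only [cgauss_neg, hφ, mul_neg, integral_neg] at h
  exact self_eq_neg.1 h.symm

/-- Circularity: multiplication by i preserves both Lebesgue measure and the weight, but changes the
sign of z². -/
theorem integral_cgauss_mul_sq {σ : ℝ} : ∫ z : ℂ, (cgauss σ z : ℂ) * (z * z) = 0 := by
  have hmp : MeasurePreserving (fun z : ℂ => Complex.I * z) := by
    have := (rotation (⟨Complex.I, by simp [Submonoid.unitSphere]⟩ : Circle)).measurePreserving
    exact this
  have h := hmp.integral_comp (measurableEmbedding_mulLeft₀ Complex.I_ne_zero)
    (fun z : ℂ => (cgauss σ z : ℂ) * (z * z))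
  have e : ∀ z : ℂ, (cgauss σ (Complex.I * z) : ℂ) * (Complex.I * z * (Complex.I * z)) =
      -((cgauss σ z : ℂ) * (z * z)) := by
    intro z
    rw [cgauss_I_mul]
    linear_combination (cgauss σ z : ℂ) * z * z * Complex.I_mul_I
  simp only [e, integral_neg] at h
  exact self_eq_neg.1 h.symm

theorem integral_cgauss_mul_normSq {σ : ℝ} (hσ : 0 < σ) :
    ∫ z : ℂ, (cgauss σ z : ℂ) * (z * conj z) = (σ : ℂ) ^ 2 := by
  have e : ∀ z : ℂ, (cgauss σ z : ℂ) * (z * conj z) = ((‖z‖ ^ 2 * cgauss σ z : ℝ) : ℂ) := by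
    intro z
    rw [Complex.mul_conj, Complex.normSq_eq_norm_sq]; push_cast; ring
  simp_rw [e]
  rw [integral_complex_ofReal, integral_norm_sq_mul_cgauss hσ]; push_cast; rfl

variable {ι : Type*} [Fintype ι]

/-- The law `CN(μ, σ² I)`. -/
noncomputable def cgaussLaw (σ : ℝ) (μ : ι → ℂ) : Measure (ι → ℂ) :=
  volume.withDensity fun y => ENNReal.ofReal (cgaussianPDF σ μ y)

theorem cgaussianPDF_nonneg (σ : ℝ) (μ y : ι → ℂ) : 0 ≤ cgaussianPDF σ μ y := by
  unfold cgaussianPDF; positivity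

theorem continuous_cgaussianPDF (σ : ℝ) (μ : ι → ℂ) : Continuous (cgaussianPDF σ μ) := by
  unfold cgaussianPDF; fun_prop

theorem cgaussianPDF_eq_prod (σ : ℝ) (y : ι → ℂ) :
    cgaussianPDF σ 0 y = ∏ i, cgauss σ (y i) := by
  simp only [cgaussianPDF, cgauss, Finset.prod_mul_distrib, Finset.prod_const, Finset.card_univ,
    ← Real.exp_sum, Pi.zero_apply, sub_zero, inv_pow, ← Finset.sum_div, Finset.sum_neg_distrib]

theorem integral_cgaussLaw {E : Type*} [NormedAddCommGroup E] [NormedSpace ℝ E] (σ : ℝ)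
    (μ : ι → ℂ) (g : (ι → ℂ) → E) :
    ∫ y, g y ∂(cgaussLaw σ μ) = ∫ y, cgaussianPDF σ μ y • g y := by
  rw [cgaussLaw, integral_withDensity_eq_integral_toReal_smul
    (continuous_cgaussianPDF σ μ).measurable.ennreal_ofReal (by simp)]
  simp only [ENNReal.toReal_ofReal (cgaussianPDF_nonneg _ _ _)]

theorem integrable_cgaussLaw_iff {E : Type*} [NormedAddCommGroup E] [NormedSpace ℝ E] {σ : ℝ}
    {μ : ι → ℂ} {g : (ι → ℂ) → E} :
    Integrable g (cgaussLaw σ μ) ↔ Integrable fun y => cgaussianPDF σ μ y • g y := by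
  rw [cgaussLaw, integrable_withDensity_iff_integrable_smul'
    (continuous_cgaussianPDF σ μ).measurable.ennreal_ofReal (by simp)]
  simp only [ENNReal.toReal_ofReal (cgaussianPDF_nonneg _ _ _)]

theorem cgaussianPDF_translate (σ : ℝ) (μ y : ι → ℂ) :
    cgaussianPDF σ μ y = cgaussianPDF σ 0 (y - μ) := by
  simp [cgaussianPDF]

theorem integral_cgaussLaw_sub {E : Type*} [NormedAddCommGroup E] [NormedSpace ℝ E] (σ : ℝ)
    (μ : ι → ℂ) (g : (ι → ℂ) → E) :
    ∫ y, g (y - μ) ∂(cgaussLaw σ μ) = ∫ y, g y ∂(cgaussLaw σ 0) := by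
  simp only [integral_cgaussLaw, cgaussianPDF_translate σ μ]
  exact integral_sub_right_eq_self (fun y => cgaussianPDF σ 0 y • g y) μ

theorem integrable_cgaussLaw_sub {E : Type*} [NormedAddCommGroup E] [NormedSpace ℝ E] {σ : ℝ}
    (μ : ι → ℂ) {g : (ι → ℂ) → E} (hg : Integrable g (cgaussLaw σ 0)) :
    Integrable (fun y => g (y - μ)) (cgaussLaw σ μ) := by
  rw [integrable_cgaussLaw_iff] at hg ⊢
  simp only [cgaussianPDF_translate σ μ]
  exact hg.comp_sub_right μ

theorem cgaussianPDF_smul_prod (σ : ℝ) (φ : ι → ℂ → ℂ) (y : ι → ℂ) :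
    cgaussianPDF σ 0 y • ∏ i, φ i (y i) = ∏ i, (cgauss σ (y i) : ℂ) * φ i (y i) := by
  rw [Finset.prod_mul_distrib, cgaussianPDF_eq_prod, Complex.real_smul, Complex.ofReal_prod]

theorem integral_cgaussLaw_prod (σ : ℝ) (φ : ι → ℂ → ℂ) :
    ∫ y, ∏ i, φ i (y i) ∂(cgaussLaw σ 0) = ∏ i, ∫ z, (cgauss σ z : ℂ) * φ i z := by
  rw [integral_cgaussLaw]
  simp only [cgaussianPDF_smul_prod]
  exact integral_fintype_prod_volume_eq_prod fun i (z : ℂ) => (cgauss σ z : ℂ) * φ i z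

theorem integrable_cgaussLaw_prod {σ : ℝ} {φ : ι → ℂ → ℂ}
    (hφ : ∀ i, Integrable fun z => (cgauss σ z : ℂ) * φ i z) :
    Integrable (fun y => ∏ i, φ i (y i)) (cgaussLaw σ 0) := by
  rw [integrable_cgaussLaw_iff]
  simp only [cgaussianPDF_smul_prod]
  exact Integrable.fintype_prod hφ

theorem integral_ofReal_cgauss {σ : ℝ} (hσ : 0 < σ) : ∫ z : ℂ, (cgauss σ z : ℂ) = 1 := by
  rw [integral_complex_ofReal, integral_cgauss hσ, Complex.ofReal_one]

instance isProbabilityMeasure_cgaussLaw {σ : ℝ} [hσ : Fact (0 < σ)] (μ : ι → ℂ) :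
    IsProbabilityMeasure (cgaussLaw σ μ) := by
  have h : ∫ _, (1 : ℂ) ∂(cgaussLaw σ μ) = 1 := by
    rw [integral_cgaussLaw_sub σ μ fun _ => (1 : ℂ)]
    simpa [integral_ofReal_cgauss hσ.out] using
      integral_cgaussLaw_prod σ (fun (_ : ι) (_ : ℂ) => (1 : ℂ))
  rw [integral_const, Complex.real_smul, mul_one] at h
  have h' : (cgaussLaw σ μ).real Set.univ = 1 := by exact_mod_cast h
  exact ⟨by rwa [Measure.real, ENNReal.toReal_eq_one_iff] at h'⟩

variable [DecidableEq ι]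

/-- Casts a function of one coordinate as a product over all coordinates, the shape in which the
product density lets Fubini apply. -/
theorem prod_update_one (φ : ℂ → ℂ) (k : ι) (y : ι → ℂ) :
    ∏ i, Function.update (fun _ _ => (1 : ℂ)) k φ i (y i) = φ (y k) := by
  rw [Finset.prod_eq_single k]
  · simp
  · intro i _ hi; simp [Function.update_of_ne hi]
  · simp

theorem prod_update_update_one (φ ψ : ℂ → ℂ) {k l : ι} (hkl : k ≠ l) (y : ι → ℂ) :
    ∏ i, Function.update (Function.update (fun _ _ => (1 : ℂ)) l ψ) k φ i (y i) =
      φ (y k) * ψ (y l) := by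
  rw [← Finset.mul_prod_erase _ _ (Finset.mem_univ k), Function.update_self]
  congr 1
  rw [Finset.prod_eq_single l]
  · simp [Function.update_of_ne hkl.symm]
  · intro i hi hil
    simp [Function.update_of_ne (Finset.ne_of_mem_erase hi), Function.update_of_ne hil]
  · intro h; exact absurd (Finset.mem_erase.2 ⟨hkl.symm, Finset.mem_univ l⟩) h

theorem integral_cgaussLaw_coord {σ : ℝ} (hσ : 0 < σ) (φ : ℂ → ℂ) (k : ι) :
    ∫ y, φ (y k) ∂(cgaussLaw σ 0) = ∫ z, (cgauss σ z : ℂ) * φ z := by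
  have h := integral_cgaussLaw_prod σ (Function.update (fun (_ : ι) (_ : ℂ) => (1 : ℂ)) k φ)
  simp only [prod_update_one] at h
  rw [h, Finset.prod_eq_single k]
  · simp
  · intro i _ hi
    simp [Function.update_of_ne hi, integral_ofReal_cgauss hσ]
  · simp

theorem integrable_cgaussLaw_coord {σ : ℝ} (hσ : 0 < σ) {φ : ℂ → ℂ} (k : ι)
    (hφ : Integrable fun z => (cgauss σ z : ℂ) * φ z) :
    Integrable (fun y : ι → ℂ => φ (y k)) (cgaussLaw σ 0) := by
  have h := integrable_cgaussLaw_prod (σ := σ)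
    (φ := Function.update (fun (_ : ι) (_ : ℂ) => (1 : ℂ)) k φ) ?_
  · simpa only [prod_update_one] using h
  · intro i
    by_cases hi : i = k
    · subst hi; simpa using hφ
    · simpa [Function.update_of_ne hi] using
        integrable_cgauss_mul hσ (φ := fun _ => 1) continuous_const fun z => by
          rw [norm_one]; nlinarith [sq_nonneg ‖z‖]

theorem integral_cgaussLaw_coord_coord_of_odd {σ : ℝ} (φ : ℂ → ℂ) {ψ : ℂ → ℂ}
    (hφ : ∀ z, φ (-z) = -φ z) {k l : ι} (hkl : k ≠ l) :
    ∫ y, φ (y k) * ψ (y l) ∂(cgaussLaw σ 0) = 0 := by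
  have h := integral_cgaussLaw_prod σ
    (Function.update (Function.update (fun (_ : ι) (_ : ℂ) => (1 : ℂ)) l ψ) k φ)
  simp only [prod_update_update_one φ ψ hkl] at h
  rw [h]
  exact Finset.prod_eq_zero (Finset.mem_univ k) (by simp [integral_cgauss_mul_of_odd hφ])

variable {σ : ℝ} (μ : ι → ℂ)

theorem memLp_noise (hσ : 0 < σ) (k : ι) :
    MemLp (fun y : ι → ℂ => y k - μ k) 2 (cgaussLaw σ μ) := by
  rw [memLp_two_iff_integrable_sq_norm
    (((continuous_apply k).sub continuous_const).aestronglyMeasurable)]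
  refine integrable_cgaussLaw_sub μ (g := fun y => ‖y k‖ ^ 2) ?_
  have := integrable_cgaussLaw_coord hσ k (φ := fun z => ((‖z‖ ^ 2 : ℝ) : ℂ))
    (integrable_cgauss_mul hσ (by fun_prop) fun z => by
      rw [Complex.norm_real, Real.norm_of_nonneg (by positivity)]; linarith)
  exact this.re

theorem integral_noise (hσ : 0 < σ) (k : ι) : ∫ y, (y k - μ k) ∂(cgaussLaw σ μ) = 0 := by
  refine (integral_cgaussLaw_sub σ μ fun y => y k).trans ?_
  rw [integral_cgaussLaw_coord hσ (fun z => z)]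
  exact integral_cgauss_mul_of_odd fun _ => rfl

theorem integral_noise_mul (hσ : 0 < σ) (k l : ι) :
    ∫ y, (y k - μ k) * (y l - μ l) ∂(cgaussLaw σ μ) = 0 := by
  refine (integral_cgaussLaw_sub σ μ fun y => y k * y l).trans ?_
  by_cases hkl : k = l
  · subst hkl
    rw [integral_cgaussLaw_coord hσ (fun z => z * z), integral_cgauss_mul_sq]
  · exact integral_cgaussLaw_coord_coord_of_odd (fun z => z) (ψ := fun z => z) (fun _ => rfl) hkl

theorem integral_noise_mul_conj (hσ : 0 < σ) (k l : ι) :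
    ∫ y, (y k - μ k) * conj (y l - μ l) ∂(cgaussLaw σ μ) =
      if k = l then (σ : ℂ) ^ 2 else 0 := by
  refine (integral_cgaussLaw_sub σ μ fun y => y k * conj (y l)).trans ?_
  split_ifs with hkl
  · subst hkl
    rw [integral_cgaussLaw_coord hσ (fun z => z * conj z), integral_cgauss_mul_normSq hσ]
  · exact integral_cgaussLaw_coord_coord_of_odd (fun z => z) (ψ := fun z => conj z)
      (fun _ => rfl) hkl

theorem memLp_dotProduct_noise (hσ : 0 < σ) (a : ι → ℂ) :
    MemLp (fun y : ι → ℂ => a ⬝ᵥ (y - μ)) 2 (cgaussLaw σ μ) :=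
  memLp_finsetSum _ fun k _ => (memLp_noise μ hσ k).const_mul (a k)

theorem integral_dotProduct_noise (hσ : 0 < σ) (a : ι → ℂ) :
    ∫ y, a ⬝ᵥ (y - μ) ∂(cgaussLaw σ μ) = 0 := by
  have : Fact (0 < σ) := ⟨hσ⟩
  simp only [dotProduct, Pi.sub_apply]
  rw [integral_finsetSum _ fun k _ =>
    ((memLp_noise μ hσ k).integrable one_le_two).const_mul (a k)]
  simp [integral_const_mul, integral_noise μ hσ]

theorem integral_mul_dotProduct_noise {e : (ι → ℂ) → ℂ} (he : MemLp e 2 (cgaussLaw σ μ))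
    (hσ : 0 < σ) (a : ι → ℂ) :
    ∫ y, e y * a ⬝ᵥ (y - μ) ∂(cgaussLaw σ μ) =
      a ⬝ᵥ fun k => ∫ y, e y * (y k - μ k) ∂(cgaussLaw σ μ) := by
  simp only [dotProduct, Pi.sub_apply, Finset.mul_sum, ← integral_const_mul]
  rw [integral_finsetSum _ fun k _ => ?_]
  · simp only [mul_left_comm]
  · exact he.integrable_mul ((memLp_noise μ hσ k).const_mul (a k))

theorem integral_mul_conj_dotProduct_noise {e : (ι → ℂ) → ℂ} (he : MemLp e 2 (cgaussLaw σ μ))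
    (hσ : 0 < σ) (a : ι → ℂ) :
    ∫ y, e y * conj (a ⬝ᵥ (y - μ)) ∂(cgaussLaw σ μ) =
      star a ⬝ᵥ fun k => ∫ y, e y * conj (y k - μ k) ∂(cgaussLaw σ μ) := by
  simp only [dotProduct, Pi.sub_apply, Pi.star_apply, map_sum, map_mul, Finset.mul_sum,
    ← integral_const_mul]
  rw [integral_finsetSum _ fun k _ => ?_]
  · simp only [mul_left_comm, RCLike.star_def]
  · exact he.integrable_mul ((memLp_noise μ hσ k).star.const_mul (conj (a k)))

theorem integral_dotProduct_noise_mul (hσ : 0 < σ) (a b : ι → ℂ) :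
    ∫ y, a ⬝ᵥ (y - μ) * b ⬝ᵥ (y - μ) ∂(cgaussLaw σ μ) = 0 := by
  rw [integral_mul_dotProduct_noise μ (memLp_dotProduct_noise μ hσ a) hσ]
  refine Finset.sum_eq_zero fun k _ => mul_eq_zero_of_right _ ?_
  simp only [mul_comm (a ⬝ᵥ _)]
  rw [integral_mul_dotProduct_noise μ (memLp_noise μ hσ k) hσ]
  simp [integral_noise_mul μ hσ]

theorem integral_dotProduct_noise_mul_conj (hσ : 0 < σ) (a b : ι → ℂ) :
    ∫ y, a ⬝ᵥ (y - μ) * conj (b ⬝ᵥ (y - μ)) ∂(cgaussLaw σ μ) = (σ : ℂ) ^ 2 * a ⬝ᵥ star b := by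
  rw [integral_mul_conj_dotProduct_noise μ (memLp_dotProduct_noise μ hσ a) hσ]
  have h : ∀ k, ∫ y, a ⬝ᵥ (y - μ) * conj (y k - μ k) ∂(cgaussLaw σ μ) = (σ : ℂ) ^ 2 * a k := by
    intro k
    simp only [mul_comm (a ⬝ᵥ _)]
    rw [integral_mul_dotProduct_noise μ (e := fun y => conj (y k - μ k))
      (memLp_noise μ hσ k).star hσ]
    simp only [mul_comm (conj _), integral_noise_mul_conj μ hσ]
    simp [dotProduct, mul_comm]
  simp only [h]
  simp only [dotProduct, Pi.star_apply, Finset.mul_sum]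
  exact Finset.sum_congr rfl fun k _ => by ring

end Gaussian

/-! ### Differentiability of expectations in the mean of the Gaussian law -/

section LocationFamily

variable {ι : Type*} [Fintype ι] {σ : ℝ} (μ : ι → ℂ)

/-- Likelihood ratio of `CN(μ + δ, σ² I)` and `CN(μ, σ² I)`. -/
noncomputable def likRatio (σ : ℝ) (μ δ y : ι → ℂ) : ℝ :=
  Real.exp ((2 * (star δ ⬝ᵥ (y - μ)).re - ∑ k, ‖δ k‖ ^ 2) / σ ^ 2)

/-- Directional derivative at `0` of the likelihood ratio in the direction `δ`. -/
noncomputable def linScore (σ : ℝ) (μ δ y : ι → ℂ) : ℝ :=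
  2 / σ ^ 2 * (star δ ⬝ᵥ (y - μ)).re

theorem sum_norm_sub_sq (a b : ι → ℂ) :
    ∑ k, ‖a k - b k‖ ^ 2 = ∑ k, ‖a k‖ ^ 2 - 2 * (star b ⬝ᵥ a).re + ∑ k, ‖b k‖ ^ 2 := by
  simp only [dotProduct, Complex.re_sum, Finset.mul_sum, ← Finset.sum_sub_distrib,
    ← Finset.sum_add_distrib]
  refine Finset.sum_congr rfl fun k _ => ?_
  simp only [← Complex.normSq_eq_norm_sq, Complex.normSq_apply, Complex.sub_re, Complex.sub_im,
    Complex.mul_re, Pi.star_apply, RCLike.star_def, Complex.conj_re, Complex.conj_im]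
  ring

/-- Completing the square in the exponent; this is the change of measure from mean μ to mean μ + δ.
-/
theorem likRatio_mul_cgaussianPDF (δ y : ι → ℂ) :
    likRatio σ μ δ y * cgaussianPDF σ μ y = cgaussianPDF σ (μ + δ) y := by
  have h : ∑ k, ‖y k - (μ + δ) k‖ ^ 2 =
      ∑ k, ‖y k - μ k‖ ^ 2 - 2 * (star δ ⬝ᵥ (y - μ)).re + ∑ k, ‖δ k‖ ^ 2 := by
    have := sum_norm_sub_sq (y - μ) δ
    simpa only [Pi.sub_apply, Pi.add_apply, sub_sub] using this
  rw [likRatio, cgaussianPDF, cgaussianPDF, h, mul_left_comm, ← Real.exp_add]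
  congr 2
  ring

/-- Reduces the second moment of a likelihood ratio to the total mass of another one, with shift 2δ.
-/
theorem likRatio_sq (δ y : ι → ℂ) :
    likRatio σ μ δ y ^ 2 =
      Real.exp (2 * (∑ k, ‖δ k‖ ^ 2) / σ ^ 2) * likRatio σ μ ((2 : ℂ) • δ) y := by
  rw [likRatio, likRatio, ← Real.exp_nat_mul, ← Real.exp_add]
  congr 1
  have h1 : (star ((2 : ℂ) • δ) ⬝ᵥ (y - μ)).re = 2 * (star δ ⬝ᵥ (y - μ)).re := by
    rw [star_smul, smul_dotProduct]; simp
  have h2 : ∑ k, ‖((2 : ℂ) • δ) k‖ ^ 2 = 4 * ∑ k, ‖δ k‖ ^ 2 := by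
    rw [Finset.mul_sum]
    refine Finset.sum_congr rfl fun k _ => ?_
    simp [mul_pow]; norm_num
  rw [h1, h2]
  push_cast
  ring

theorem continuous_likRatio (δ : ι → ℂ) : Continuous (likRatio σ μ δ) := by
  unfold likRatio dotProduct; fun_prop

variable {E : Type*} [NormedAddCommGroup E] [NormedSpace ℝ E]

theorem integral_likRatio_smul (δ : ι → ℂ) (g : (ι → ℂ) → E) :
    ∫ y, likRatio σ μ δ y • g y ∂(cgaussLaw σ μ) = ∫ y, g y ∂(cgaussLaw σ (μ + δ)) := by
  simp only [integral_cgaussLaw, smul_smul, mul_comm (cgaussianPDF σ μ _),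
    likRatio_mul_cgaussianPDF]

theorem integrable_likRatio_smul {δ : ι → ℂ} {g : (ι → ℂ) → E} :
    Integrable (fun y => likRatio σ μ δ y • g y) (cgaussLaw σ μ) ↔
      Integrable g (cgaussLaw σ (μ + δ)) := by
  simp only [integrable_cgaussLaw_iff, smul_smul, mul_comm (cgaussianPDF σ μ _),
    likRatio_mul_cgaussianPDF]

theorem integrable_likRatio (hσ : 0 < σ) (δ : ι → ℂ) :
    Integrable (likRatio σ μ δ) (cgaussLaw σ μ) := by
  have : Fact (0 < σ) := ⟨hσ⟩
  simpa using (integrable_likRatio_smul μ (δ := δ) (g := fun _ => (1 : ℝ))).2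
    (integrable_const _)

theorem integral_likRatio (hσ : 0 < σ) (δ : ι → ℂ) :
    ∫ y, likRatio σ μ δ y ∂(cgaussLaw σ μ) = 1 := by
  have : Fact (0 < σ) := ⟨hσ⟩
  simpa using integral_likRatio_smul (σ := σ) μ δ fun _ => (1 : ℝ)

theorem memLp_likRatio (hσ : 0 < σ) (δ : ι → ℂ) :
    MemLp (likRatio σ μ δ) 2 (cgaussLaw σ μ) := by
  rw [memLp_two_iff_integrable_sq (continuous_likRatio μ δ).aestronglyMeasurable]
  simp only [likRatio_sq]
  exact (integrable_likRatio μ hσ _).const_mul _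

variable [DecidableEq ι]

theorem memLp_linScore (hσ : 0 < σ) (δ : ι → ℂ) :
    MemLp (linScore σ μ δ) 2 (cgaussLaw σ μ) :=
  (memLp_dotProduct_noise μ hσ (star δ)).re.const_mul _

theorem integral_linScore (hσ : 0 < σ) (δ : ι → ℂ) :
    ∫ y, linScore σ μ δ y ∂(cgaussLaw σ μ) = 0 := by
  have : Fact (0 < σ) := ⟨hσ⟩
  simp only [linScore]
  rw [integral_const_mul]
  have h := integral_re ((memLp_dotProduct_noise μ hσ (star δ)).integrable one_le_two)
  rw [integral_dotProduct_noise μ hσ] at h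
  simp only [RCLike.re_to_complex] at h
  rw [h]; simp

theorem integral_linScore_sq (hσ : 0 < σ) (δ : ι → ℂ) :
    ∫ y, linScore σ μ δ y ^ 2 ∂(cgaussLaw σ μ) = 2 * (∑ k, ‖δ k‖ ^ 2) / σ ^ 2 := by
  have hz := memLp_dotProduct_noise μ hσ (star δ)
  have i1 : Integrable (fun y => (star δ ⬝ᵥ (y - μ)) * (star δ ⬝ᵥ (y - μ))) (cgaussLaw σ μ) :=
    hz.integrable_mul hz
  have i2 : Integrable (fun y => (star δ ⬝ᵥ (y - μ)) * conj (star δ ⬝ᵥ (y - μ)))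
    (cgaussLaw σ μ) := hz.integrable_mul hz.star
  -- Uses 2 (Re z)² = Re (z² + z z̄); the z² term then integrates to 0 by circularity.
  have e : ∀ y, linScore σ μ δ y ^ 2 = 2 / σ ^ 4 *
      ((star δ ⬝ᵥ (y - μ)) * (star δ ⬝ᵥ (y - μ)) +
        (star δ ⬝ᵥ (y - μ)) * conj (star δ ⬝ᵥ (y - μ))).re := by
    intro y
    simp only [linScore, Complex.add_re, Complex.mul_re, Complex.conj_re, Complex.conj_im]
    ring
  simp only [e]
  rw [integral_const_mul]
  have h := integral_re (i1.add i2)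
  simp only [RCLike.re_to_complex, Pi.add_apply] at h
  rw [h, integral_add i1 i2, integral_dotProduct_noise_mul μ hσ,
    integral_dotProduct_noise_mul_conj μ hσ]
  have hs : star δ ⬝ᵥ star (star δ) = ((∑ k, ‖δ k‖ ^ 2 : ℝ) : ℂ) := by
    simp [dotProduct, Complex.conj_mul']
  rw [hs, zero_add, ← Complex.ofReal_pow, ← Complex.ofReal_mul, Complex.ofReal_re]
  field_simp

theorem integral_likRatio_mul_linScore (hσ : 0 < σ) (δ : ι → ℂ) :
    ∫ y, likRatio σ μ δ y * linScore σ μ δ y ∂(cgaussLaw σ μ) =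
      2 * (∑ k, ‖δ k‖ ^ 2) / σ ^ 2 := by
  have : Fact (0 < σ) := ⟨hσ⟩
  refine (integral_likRatio_smul μ δ (linScore σ μ δ)).trans ?_
  -- The ratio moves the integral to mean μ + δ, where the score is centred up to this constant.
  have e : ∀ y, linScore σ μ δ y =
      linScore σ (μ + δ) δ y + 2 * (∑ k, ‖δ k‖ ^ 2) / σ ^ 2 := by
    intro y
    have hs : (star δ ⬝ᵥ δ).re = ∑ k, ‖δ k‖ ^ 2 := by
      simp [dotProduct, Complex.conj_mul', ← Complex.ofReal_pow]
    rw [linScore, linScore, show y - μ = y - (μ + δ) + δ by abel, dotProduct_add, Complex.add_re,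
      hs]
    ring
  simp only [e]
  rw [integral_add ((memLp_linScore (μ + δ) hσ δ).integrable one_le_two) (integrable_const _),
    integral_linScore (μ + δ) hσ]
  simp

/-- The quadratic mean error of the first-order expansion of the likelihood ratio. -/
theorem integral_likRatio_remainder_sq (hσ : 0 < σ) (δ : ι → ℂ) :
    ∫ y, (likRatio σ μ δ y - 1 - linScore σ μ δ y) ^ 2 ∂(cgaussLaw σ μ) =
      Real.exp (2 * (∑ k, ‖δ k‖ ^ 2) / σ ^ 2) - 1 - 2 * (∑ k, ‖δ k‖ ^ 2) / σ ^ 2 := by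
  have : Fact (0 < σ) := ⟨hσ⟩
  have hL := memLp_likRatio μ hσ δ
  have hl := memLp_linScore μ hσ δ
  have iL := hL.integrable one_le_two
  have il := hl.integrable one_le_two
  have iL2 : Integrable (fun y => likRatio σ μ δ y ^ 2) (cgaussLaw σ μ) := hL.integrable_sq
  have il2 : Integrable (fun y => linScore σ μ δ y ^ 2) (cgaussLaw σ μ) := hl.integrable_sq
  have iLl : Integrable (fun y => likRatio σ μ δ y * linScore σ μ δ y) (cgaussLaw σ μ) :=
    hL.integrable_mul hl
  have h : ∫ y, (likRatio σ μ δ y - 1 - linScore σ μ δ y) ^ 2 ∂(cgaussLaw σ μ) =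
      ∫ y, (likRatio σ μ δ y ^ 2 + 1 + linScore σ μ δ y ^ 2 - 2 * likRatio σ μ δ y -
        2 * (likRatio σ μ δ y * linScore σ μ δ y) + 2 * linScore σ μ δ y) ∂(cgaussLaw σ μ) := by
    congr 1; ext y; ring
  have i1 : Integrable (fun y => likRatio σ μ δ y ^ 2 + 1) (cgaussLaw σ μ) :=
    iL2.add (integrable_const 1)
  have i2 : Integrable (fun y => likRatio σ μ δ y ^ 2 + 1 + linScore σ μ δ y ^ 2)
    (cgaussLaw σ μ) := i1.add il2
  have i3 : Integrable (fun y => likRatio σ μ δ y ^ 2 + 1 + linScore σ μ δ y ^ 2 -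
    2 * likRatio σ μ δ y) (cgaussLaw σ μ) := i2.sub (iL.const_mul 2)
  have i4 : Integrable (fun y => likRatio σ μ δ y ^ 2 + 1 + linScore σ μ δ y ^ 2 -
    2 * likRatio σ μ δ y - 2 * (likRatio σ μ δ y * linScore σ μ δ y)) (cgaussLaw σ μ) :=
    i3.sub (iLl.const_mul 2)
  rw [h, integral_add i4 (il.const_mul 2), integral_sub i3 (iLl.const_mul 2),
    integral_sub i2 (iL.const_mul 2), integral_add i1 il2, integral_add iL2 (integrable_const 1)]
  simp only [integral_const_mul, integral_likRatio μ hσ, integral_linScore μ hσ,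
    integral_linScore_sq μ hσ, integral_likRatio_mul_linScore μ hσ, likRatio_sq]
  simp
  ring

/-- Cauchy-Schwarz together with the exact value eˣ - 1 - x of the squared remainder, x = 2‖δ‖²/σ²
in the Euclidean norm. For x ≤ 1 it is at most x², so its root is at most x, which is quadratic in
δ. -/
theorem norm_integral_likRatio_remainder_le (hσ : 0 < σ) {e : (ι → ℂ) → ℂ}
    (he : MemLp e 2 (cgaussLaw σ μ)) {δ : ι → ℂ} (hδ : 2 * (∑ k, ‖δ k‖ ^ 2) / σ ^ 2 ≤ 1) :
    ‖∫ y, (likRatio σ μ δ y - 1 - linScore σ μ δ y : ℝ) • e y ∂(cgaussLaw σ μ)‖ ≤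
      (2 * (∑ k, ‖δ k‖ ^ 2) / σ ^ 2) * √(∫ y, ‖e y‖ ^ 2 ∂(cgaussLaw σ μ)) := by
  have : Fact (0 < σ) := ⟨hσ⟩
  have hR : MemLp (fun y => likRatio σ μ δ y - 1 - linScore σ μ δ y) 2 (cgaussLaw σ μ) :=
    ((memLp_likRatio μ hσ δ).sub (memLp_const 1)).sub (memLp_linScore μ hσ δ)
  have hCS := integral_mul_norm_le_Lp_mul_Lq (μ := cgaussLaw σ μ) Real.HolderConjugate.two_two
    (f := fun y => likRatio σ μ δ y - 1 - linScore σ μ δ y) (g := fun y => ‖e y‖)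
    (by simpa using hR) (by simpa using he.norm)
  refine (norm_integral_le_integral_norm _).trans ?_
  simp only [norm_smul]
  simp only [norm_norm] at hCS
  refine hCS.trans ?_
  simp only [Real.rpow_two, ← Real.sqrt_eq_rpow]
  refine mul_le_mul_of_nonneg_right ?_ (Real.sqrt_nonneg _)
  simp only [Real.norm_eq_abs, sq_abs]
  rw [integral_likRatio_remainder_sq μ hσ]
  have h0 : 0 ≤ 2 * (∑ k, ‖δ k‖ ^ 2) / σ ^ 2 := by positivity
  refine Real.sqrt_le_iff.2 ⟨h0, ?_⟩
  have := Real.abs_exp_sub_one_sub_id_le (x := 2 * (∑ k, ‖δ k‖ ^ 2) / σ ^ 2)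
    (by rwa [abs_of_nonneg h0])
  exact (le_abs_self _).trans this

theorem integrable_real_smul {Ω : Type*} [MeasurableSpace Ω] {ν : Measure Ω} {φ : Ω → ℝ}
    {e : Ω → ℂ} (hφ : MemLp φ 2 ν) (he : MemLp e 2 ν) : Integrable (fun y => φ y • e y) ν :=
  memLp_one_iff_integrable.1 (MemLp.smul (p := 2) (q := 2) he hφ)

theorem isLittleO_sum_norm_sq {ι : Type*} [Fintype ι] :
    (fun δ : ι → ℂ => ∑ k, ‖δ k‖ ^ 2) =o[𝓝 0] fun δ => δ := by
  have hk : ∀ k : ι, (fun δ : ι → ℂ => ‖δ k‖ ^ 2) =o[𝓝 0] fun δ => δ := fun k => by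
    have h1 : (fun δ : ι → ℂ => δ k) =O[𝓝 0] fun δ => δ :=
      (ContinuousLinearMap.proj (R := ℝ) (φ := fun _ : ι => ℂ) k).isBigO_id _
    have h2 : (fun δ : ι → ℂ => ‖δ k‖) =o[𝓝 0] fun _ => (1 : ℝ) := by
      rw [isLittleO_one_iff]
      have : Continuous fun δ : ι → ℂ => ‖δ k‖ := by fun_prop
      simpa using this.tendsto 0
    simpa [pow_two] using h2.smul_isBigO h1.norm_left
  simpa only [Finset.sum_fn] using IsLittleO.sum fun k (_ : k ∈ Finset.univ) => hk k

/-- Expectations of square integrable functions are differentiable in the mean of the law. -/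
theorem hasFDerivAt_integral_cgaussLaw (hσ : 0 < σ) {e : (ι → ℂ) → ℂ}
    (he : MemLp e 2 (cgaussLaw σ μ)) :
    ∃ D : (ι → ℂ) →L[ℝ] ℂ, HasFDerivAt (fun ν => ∫ y, e y ∂(cgaussLaw σ ν)) D μ ∧
      ∀ δ, D δ = ∫ y, linScore σ μ δ y • e y ∂(cgaussLaw σ μ) := by
  have : Fact (0 < σ) := ⟨hσ⟩
  have hi : ∀ δ, Integrable (fun y => linScore σ μ δ y • e y) (cgaussLaw σ μ) := fun δ =>
    integrable_real_smul (memLp_linScore μ hσ δ) he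
  let D₀ : (ι → ℂ) →ₗ[ℝ] ℂ :=
    { toFun := fun δ => ∫ y, linScore σ μ δ y • e y ∂(cgaussLaw σ μ)
      map_add' := fun δ δ' => by
        rw [← integral_add (hi δ) (hi δ')]
        simp only [linScore, star_add, add_dotProduct, Complex.add_re, mul_add, add_smul]
      map_smul' := fun c δ => by
        rw [RingHom.id_apply, ← integral_smul]
        refine integral_congr_ae (.of_forall fun y => ?_)
        have : star (c • δ) ⬝ᵥ (y - μ) = c • (star δ ⬝ᵥ (y - μ)) := by
          rw [star_smul, smul_dotProduct]; simp
        simp only [linScore, this, smul_smul, Complex.smul_re, smul_eq_mul]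
        congr 1; ring }
  refine ⟨D₀.toContinuousLinearMap, ?_, fun δ => rfl⟩
  rw [hasFDerivAt_iff_isLittleO_nhds_zero]
  -- The increment minus its linear part is the integral of `e` against the likelihood remainder,
  -- hence quadratically small.
  have hO : (fun δ : ι → ℂ => (∫ y, e y ∂(cgaussLaw σ (μ + δ))) - (∫ y, e y ∂(cgaussLaw σ μ)) -
      D₀ δ) =O[𝓝 0] fun δ => ∑ k, ‖δ k‖ ^ 2 := by
    refine IsBigO.of_bound (2 / σ ^ 2 * √(∫ y, ‖e y‖ ^ 2 ∂(cgaussLaw σ μ))) ?_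
    have hsmall : ∀ᶠ δ : ι → ℂ in 𝓝 0, 2 * (∑ k, ‖δ k‖ ^ 2) / σ ^ 2 ≤ 1 := by
      have hc : Continuous fun δ : ι → ℂ => 2 * (∑ k, ‖δ k‖ ^ 2) / σ ^ 2 := by fun_prop
      have ht := hc.tendsto 0
      simp only [Pi.zero_apply, norm_zero, ne_eq, OfNat.ofNat_ne_zero, not_false_eq_true,
        zero_pow, Finset.sum_const_zero, mul_zero, zero_div] at ht
      exact (ht.eventually_lt_const one_pos).mono fun _ h => h.le
    filter_upwards [hsmall] with δ hδ
    have iLe : Integrable (fun y => likRatio σ μ δ y • e y) (cgaussLaw σ μ) :=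
      integrable_real_smul (memLp_likRatio μ hσ δ) he
    have ie : Integrable e (cgaussLaw σ μ) := he.integrable one_le_two
    have heq : (∫ y, e y ∂(cgaussLaw σ (μ + δ))) - (∫ y, e y ∂(cgaussLaw σ μ)) - D₀ δ =
        ∫ y, (likRatio σ μ δ y - 1 - linScore σ μ δ y : ℝ) • e y ∂(cgaussLaw σ μ) := by
      simp only [sub_smul, one_smul]
      have i1 : Integrable (fun y => likRatio σ μ δ y • e y - e y) (cgaussLaw σ μ) := iLe.sub ie
      rw [integral_sub i1 (hi δ), integral_sub iLe ie, integral_likRatio_smul]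
      rfl
    rw [heq, Real.norm_of_nonneg (Finset.sum_nonneg fun k _ => by positivity)]
    refine (norm_integral_likRatio_remainder_le μ hσ he hδ).trans (le_of_eq ?_)
    ring
  exact hO.trans_isLittleO isLittleO_sum_norm_sq

end LocationFamily

/-! ### Score and Fisher information of a Gaussian model -/

section GaussianModel

variable {n ι : Type*} [Fintype n] [DecidableEq n] [Fintype ι]

theorem wirtingerConj_eq {φ : (n → ℂ) → ℂ} {φ' : (n → ℂ) →L[ℝ] ℂ} {x : n → ℂ}
    (h : HasFDerivAt φ φ' x) (k : n) :
    wirtingerConj φ x k = (1 / 2) * (φ' (Pi.single k 1) + Complex.I * φ' (Pi.single k Complex.I)) := by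
  rw [wirtingerConj, h.fderiv]

theorem log_cgaussianPDF {σ : ℝ} (hσ : 0 < σ) (μ y : ι → ℂ) :
    Real.log (cgaussianPDF σ μ y) =
      Real.log ((Real.pi * σ ^ 2) ^ Fintype.card ι)⁻¹ - (∑ k, ‖y k - μ k‖ ^ 2) / σ ^ 2 := by
  have := Real.pi_pos
  rw [cgaussianPDF, Real.log_mul (by positivity) (Real.exp_ne_zero _), Real.log_exp]
  ring

theorem score_cgaussianPDF {σ : ℝ} (hσ : 0 < σ) {m : (n → ℂ) → ι → ℂ} {θ : n → ℂ}
    {D : (n → ℂ) →L[ℝ] ι → ℂ} (hm : HasFDerivAt m D θ) {A : Matrix ι n ℂ}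
    (hD : ∀ v, D v = A *ᵥ v) (y : ι → ℂ) :
    score (fun θ => cgaussianPDF σ (m θ)) θ y =
      ((1 / σ ^ 2 : ℝ) : ℂ) • (Aᴴ *ᵥ (y - m θ)) := by
  have hk : ∀ k, HasFDerivAt (fun θ' => ‖y k - m θ' k‖ ^ 2)
      (2 • (innerSL ℝ (y k - m θ k)).comp
        (-((ContinuousLinearMap.proj k : (ι → ℂ) →L[ℝ] ℂ).comp D))) θ := fun k =>
    (((hasFDerivAt_pi'.1 hm) k).const_sub (y k)).norm_sq
  have h1 := ((HasFDerivAt.fun_sum fun k (_ : k ∈ Finset.univ) => hk k).const_mul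
    (1 / σ ^ 2)).const_sub (Real.log ((Real.pi * σ ^ 2) ^ Fintype.card ι)⁻¹)
  have h2 := Complex.ofRealCLM.hasFDerivAt.comp θ h1
  have h3 : HasFDerivAt (fun θ' => ((Real.log (cgaussianPDF σ (m θ') y) : ℝ) : ℂ)) _ θ :=
    h2.congr_of_eventuallyEq (.of_forall fun θ' => by
      simp only [log_cgaussianPDF hσ, Function.comp, Complex.ofRealCLM_apply]
      congr 2; ring)
  have hval : ∀ k c, (Complex.ofRealCLM.comp (-((1 / σ ^ 2) • ∑ k,
      2 • (innerSL ℝ (y k - m θ k)).comp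
        (-((ContinuousLinearMap.proj k : (ι → ℂ) →L[ℝ] ℂ).comp D))))) (Pi.single k c) =
      ((2 / σ ^ 2 * (conj c * (Aᴴ *ᵥ (y - m θ)) k).re : ℝ) : ℂ) := by
    intro k c
    simp only [ContinuousLinearMap.comp_apply, _root_.neg_apply, _root_.smul_apply,
      _root_.sum_apply, hD, ContinuousLinearMap.proj_apply, Complex.ofRealCLM_apply,
      innerSL_apply_apply, Complex.inner, mulVec_single, Pi.smul_apply, mulVec, dotProduct,
      Pi.sub_apply, conjTranspose_apply, Finset.mul_sum, Complex.re_sum, smul_eq_mul,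
      ← Finset.sum_neg_distrib]
    congr 1
    refine Finset.sum_congr rfl fun r _ => ?_
    simp [Matrix.col_apply]
    ring
  ext k
  rw [score, wirtingerConj_eq h3, hval, hval, Pi.smul_apply]
  set z := (Aᴴ *ᵥ (y - m θ)) k with hz
  -- The directions 1 and i extract the real and imaginary parts of z; the Wirtinger combination
  -- reassembles z.
  have h1 : (conj 1 * z).re = z.re := by simp
  have hI : (conj Complex.I * z).re = z.im := by simp
  rw [h1, hI, smul_eq_mul]
  conv_rhs => rw [← Complex.re_add_im z]
  push_cast
  ring

/-- The score is σ⁻²Aᴴ times noise of covariance σ²I, so two factors σ⁻² meet one σ². -/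
theorem fisherMatrix_cgaussianPDF [DecidableEq ι] {σ : ℝ} (hσ : 0 < σ) {m : (n → ℂ) → ι → ℂ}
    {θ : n → ℂ} {D : (n → ℂ) →L[ℝ] ι → ℂ} (hm : HasFDerivAt m D θ) {A : Matrix ι n ℂ}
    (hD : ∀ v, D v = A *ᵥ v) :
    fisherMatrix volume (fun θ => cgaussianPDF σ (m θ)) θ =
      ((1 / σ ^ 2 : ℝ) : ℂ) • (Aᴴ * A) := by
  have hσ' : (σ : ℂ) ≠ 0 := by exact_mod_cast hσ.ne'
  ext k l
  rw [fisherMatrix, of_apply]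
  simp only [score_cgaussianPDF hσ hm hD]
  change ∫ y, _ ∂(cgaussLaw σ (m θ)) = _
  have e : ∀ y, (((1 / σ ^ 2 : ℝ) : ℂ) • (Aᴴ *ᵥ (y - m θ))) k *
      conj ((((1 / σ ^ 2 : ℝ) : ℂ) • (Aᴴ *ᵥ (y - m θ))) l) =
      (1 / (σ : ℂ) ^ 4) * (Aᴴ k ⬝ᵥ (y - m θ) * conj (Aᴴ l ⬝ᵥ (y - m θ))) := by
    intro y
    simp only [Pi.smul_apply, smul_eq_mul, map_mul, Complex.conj_ofReal, mulVec]
    push_cast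
    ring
  simp only [e]
  rw [integral_const_mul, integral_dotProduct_noise_mul_conj _ hσ, Matrix.smul_apply, mul_apply]
  have : Aᴴ k ⬝ᵥ star (Aᴴ l) = ∑ j, Aᴴ k j * A j l := by
    simp [dotProduct]
  rw [this]
  push_cast
  rw [smul_eq_mul]
  field_simp

end GaussianModel

/-! ### The bilinear model -/

section CalibrationModel

variable {M G : ℕ} {grp : Fin M → Fin G} {L : Fin G → ℕ}
  (P : ∀ i, Matrix (AntGroup grp i) (Fin (L i)) ℂ)

theorem atGroup_mulVec {R : Type*} (i : Fin G) (B : Matrix R (AntGroup grp i) ℂ) (f : Fin M → ℂ)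
    (r : R) : (atGroup i B *ᵥ f) r = ∑ a : AntGroup grp i, B r a * f a.1 := by
  simp only [mulVec, dotProduct]
  rw [← Fintype.sum_subtype_add_sum_subtype (fun a => grp a = i)
    (fun a => atGroup i B r a * f a), Finset.sum_congr rfl fun a _ => ?_,
    Finset.sum_eq_zero (s := Finset.univ) (f := fun a : {a // ¬grp a = i} => _) fun a _ => ?_,
    add_zero]
  · simp [atGroup, a.2]
  · simp [atGroup, a.2]

theorem calH_mulVec_inl (h : ChanIdx grp → ℂ) (f : Fin M → ℂ) (p : GroupPair G)
    (x : Fin (L p.1.1) × AntGroup grp p.1.2) :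
    (calH P h *ᵥ f) ⟨p, Sum.inl x⟩ = ∑ a, P p.1.1 a x.1 * h ⟨p, (a, x.2)⟩ * f a.1 :=
  atGroup_mulVec p.1.1 (khatriRao (P p.1.1)ᵀ (chanMat h p)) f x

theorem calH_mulVec_inr (h : ChanIdx grp → ℂ) (f : Fin M → ℂ) (p : GroupPair G)
    (x : AntGroup grp p.1.1 × Fin (L p.1.2)) :
    (calH P h *ᵥ f) ⟨p, Sum.inr x⟩ = ∑ b, h ⟨p, (x.1, b)⟩ * P p.1.2 b x.2 * f b.1 :=
  atGroup_mulVec p.1.2 (khatriRao (chanMat h p)ᵀ (P p.1.2)ᵀ) f x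

/-- Each observed entry is a sum of products pilot · channel · calibration coefficient; the two
composite matrices differ only in which of the last two factors is treated as the unknown. -/
theorem calH_mulVec (h : ChanIdx grp → ℂ) (f : Fin M → ℂ) :
    calH P h *ᵥ f = calF P f *ᵥ h := by
  ext ⟨p, x⟩
  have hF : (calF P f *ᵥ h) ⟨p, x⟩ = ∑ c, (Matrix.fromRows
      (((P p.1.1)ᵀ * calDiag grp f p.1.1) ⊗ₖ
        (1 : Matrix (AntGroup grp p.1.2) (AntGroup grp p.1.2) ℂ))
      ((1 : Matrix (AntGroup grp p.1.1) (AntGroup grp p.1.1) ℂ) ⊗ₖ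
        ((P p.1.2)ᵀ * calDiag grp f p.1.2))) x c * h ⟨p, c⟩ := by
    simp only [mulVec, dotProduct, calF]
    rw [Fintype.sum_sigma, Finset.sum_eq_single p]
    · simp only [blockDiagonal'_apply_eq]
    · intro q _ hq
      simp only [blockDiagonal'_apply_ne _ _ _ hq.symm, zero_mul, Finset.sum_const_zero]
    · simp
  rw [hF, Fintype.sum_prod_type]
  rcases x with x | x
  · rw [calH_mulVec_inl]
    refine Finset.sum_congr rfl fun a _ => ?_
    simp only [fromRows_apply_inl, kroneckerMap_apply, calDiag, mul_diagonal, transpose_apply]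
    rw [Finset.sum_eq_single x.2 (fun b _ hb => by rw [one_apply_ne hb.symm]; simp) (by simp),
      one_apply_eq]
    ring
  · rw [calH_mulVec_inr, Finset.sum_comm]
    refine Finset.sum_congr rfl fun b _ => ?_
    simp only [fromRows_apply_inr, kroneckerMap_apply, calDiag, mul_diagonal, transpose_apply]
    rw [Finset.sum_eq_single x.1 (fun a _ ha => by rw [one_apply_ne ha.symm]; simp) (by simp),
      one_apply_eq]
    ring

/-- Linearity in `h` is immediate once the product is written as 𝓕(f)h. -/
theorem calH_add_mulVec (h h' : ChanIdx grp → ℂ) (f : Fin M → ℂ) :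
    calH P (h + h') *ᵥ f = calH P h *ᵥ f + calH P h' *ᵥ f := by
  simp only [calH_mulVec, mulVec_add]

theorem calH_smul_mulVec (c : ℝ) (h : ChanIdx grp → ℂ) (f : Fin M → ℂ) :
    calH P (c • h) *ᵥ f = c • (calH P h *ᵥ f) := by
  simp only [calH_mulVec, mulVec_smul]

/-- The mean of the observation, as a function of the joint parameter `(f, h)`. -/
noncomputable def calMean (θ : Fin M ⊕ ChanIdx grp → ℂ) : ObsIdx grp L → ℂ :=
  calH P (θ ∘ Sum.inr) *ᵥ (θ ∘ Sum.inl)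

/-- The Jacobian matrix `[𝓗 𝓕]` of the mean. -/
noncomputable def calJac (f : Fin M → ℂ) (h : ChanIdx grp → ℂ) :
    Matrix (ObsIdx grp L) (Fin M ⊕ ChanIdx grp) ℂ :=
  fromCols (calH P h) (calF P f)

theorem calJac_mulVec (f : Fin M → ℂ) (h : ChanIdx grp → ℂ) (v : Fin M ⊕ ChanIdx grp → ℂ) :
    calJac P f h *ᵥ v = calH P h *ᵥ (v ∘ Sum.inl) + calF P f *ᵥ (v ∘ Sum.inr) :=
  fromCols_mulVec _ _ _

theorem hasFDerivAt_calMean (f : Fin M → ℂ) (h : ChanIdx grp → ℂ) :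
    ∃ D : (Fin M ⊕ ChanIdx grp → ℂ) →L[ℝ] (ObsIdx grp L → ℂ),
      HasFDerivAt (calMean P) D (Sum.elim f h) ∧ ∀ v, D v = calJac P f h *ᵥ v := by
  let B : (ChanIdx grp → ℂ) →ₗ[ℝ] (Fin M → ℂ) →ₗ[ℝ] (ObsIdx grp L → ℂ) :=
    LinearMap.mk₂ ℝ (fun h f => calH P h *ᵥ f) (calH_add_mulVec P) (calH_smul_mulVec P)
      (fun h f f' => mulVec_add _ _ _) (fun c h f => mulVec_smul _ _ _)
  let pl : (Fin M ⊕ ChanIdx grp → ℂ) →L[ℝ] (Fin M → ℂ) :=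
    (LinearMap.funLeft ℝ ℂ Sum.inl).toContinuousLinearMap
  let pr : (Fin M ⊕ ChanIdx grp → ℂ) →L[ℝ] (ChanIdx grp → ℂ) :=
    (LinearMap.funLeft ℝ ℂ Sum.inr).toContinuousLinearMap
  refine ⟨_, B.toContinuousBilinearMap.hasFDerivAt_of_bilinear
    (pr.hasFDerivAt (x := Sum.elim f h)) (pl.hasFDerivAt (x := Sum.elim f h)), fun v => ?_⟩
  -- Rewriting 𝓕(f) applied to the variation of h as 𝓗 of that variation applied to f turns the
  -- Jacobian into the product rule.
  rw [calJac_mulVec, ← calH_mulVec]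
  rfl

theorem calFIM_eq {σ : ℝ} (hσ : 0 < σ) (f : Fin M → ℂ) (h : ChanIdx grp → ℂ) :
    calFIM σ P f h = ((1 / σ ^ 2 : ℝ) : ℂ) • ((calJac P f h)ᴴ * calJac P f h) := by
  obtain ⟨D, hD, hDv⟩ := hasFDerivAt_calMean P f h
  exact fisherMatrix_cgaussianPDF hσ hD hDv

theorem calGram_conjTranspose (f : Fin M → ℂ) (h : ChanIdx grp → ℂ) :
    (calGram P f h)ᴴ = calGram P f h := by
  simp only [calGram, conjTranspose_mul, conjTranspose_conjTranspose, colProjPerp_conjTranspose,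
    Matrix.mul_assoc]

theorem wirtingerConj_comp_inl {C : (Fin M → ℂ) → ℂ} {f : Fin M → ℂ} (h : ChanIdx grp → ℂ)
    (hC : DifferentiableAt ℝ C f) :
    wirtingerConj (fun θ : Fin M ⊕ ChanIdx grp → ℂ => C (θ ∘ Sum.inl)) (Sum.elim f h) =
      Sum.elim (wirtingerConj C f) 0 := by
  let pl : (Fin M ⊕ ChanIdx grp → ℂ) →L[ℝ] (Fin M → ℂ) :=
    (LinearMap.funLeft ℝ ℂ Sum.inl).toContinuousLinearMap
  have h1 : HasFDerivAt (fun θ : Fin M ⊕ ChanIdx grp → ℂ => C (θ ∘ Sum.inl))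
      ((fderiv ℝ C f).comp pl) (Sum.elim f h) :=
    HasFDerivAt.comp (g := C) (f := pl) _ hC.hasFDerivAt pl.hasFDerivAt
  have hpl : ∀ v, pl v = v ∘ Sum.inl := fun v => rfl
  ext k
  rw [wirtingerConj_eq h1]
  rcases k with k | k
  · have : ∀ c : ℂ, (Pi.single (Sum.inl k) c : Fin M ⊕ ChanIdx grp → ℂ) ∘ Sum.inl =
        Pi.single k c := fun c => by
      ext i; simp [Pi.single_apply]
    simp only [ContinuousLinearMap.comp_apply, hpl, this, Sum.elim_inl, wirtingerConj]
  · have : ∀ c : ℂ, (Pi.single (Sum.inr k) c : Fin M ⊕ ChanIdx grp → ℂ) ∘ Sum.inl = 0 :=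
      fun c => by ext i; simp
    simp only [ContinuousLinearMap.comp_apply, hpl, this, Sum.elim_inr, map_zero]
    simp

theorem replicateCol_sumElim_zero (q : Fin M → ℂ) :
    replicateCol Unit (Sum.elim q (0 : ChanIdx grp → ℂ)) =
      fromRows (replicateCol Unit q) (0 : Matrix (ChanIdx grp) Unit ℂ) := by
  ext (i | i) j <;> rfl

/-- The constrained Cramér-Rao bound in terms of the generalized inverse `W` of the Schur
complement. -/
theorem calCRB_eq {σ : ℝ} (hσ : 0 < σ) {f : Fin M → ℂ} {h : ChanIdx grp → ℂ}
    {C : (Fin M → ℂ) → ℂ} (hC : DifferentiableAt ℝ C f) {W Q : Matrix (Fin M) (Fin M) ℂ}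
    (hQ : Q = colProjPerp (replicateCol Unit (wirtingerConj C f))) (hW : Wᴴ = W)
    (hWQ : W * Q = W) (hKQ : W * calGram P f h * Q = Q) :
    calCRB σ P f h C = ((σ ^ 2 : ℝ) : ℂ) • W := by
  rw [calCRB, constrainedCRB, calFIM_eq P hσ, wirtingerConj_comp_inl h hC,
    replicateCol_sumElim_zero, colProjPerp_fromRows_zero, ← hQ, Matrix.mul_smul, Matrix.smul_mul,
    pinv_smul (by positivity), one_div, inv_inv, calJac]
  have key := pinv_compressed_gram (calH P h) (calF P f)
    (by rw [hQ]; exact colProjPerp_conjTranspose _) hW hWQ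
    (by rw [hQ]; exact colProjPerp_mul_colProjPerp _) hKQ
  calc _ = ((σ ^ 2 : ℝ) : ℂ) • (pinv _).toBlocks₁₁ := rfl
    _ = _ := by rw [key]

end CalibrationModel

/-! ### Regular constraints -/

section Constraint

theorem colProjPerp_mulVec_eq_self_iff {m n : Type*} [Fintype m] [DecidableEq m] [Fintype n]
    {X : Matrix m n ℂ} {v : m → ℂ} : colProjPerp X *ᵥ v = v ↔ Xᴴ *ᵥ v = 0 := by
  constructor
  · intro h
    rw [← h, mulVec_mulVec, conjTranspose_mul_colProjPerp, zero_mulVec]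
  · intro h
    rw [colProjPerp, sub_mulVec, one_mulVec, colProj, ← mulVec_mulVec, h, mulVec_zero, sub_zero]

theorem clm_apply_eq_sum_single {n : Type*} [Fintype n] [DecidableEq n]
    (D : (n → ℂ) →L[ℝ] ℂ) (v : n → ℂ) :
    D v = ∑ k, ((v k).re * D (Pi.single k 1) + (v k).im * D (Pi.single k Complex.I)) := by
  have h : v = ∑ k, ((v k).re • (Pi.single k 1 : n → ℂ) + (v k).im • (Pi.single k Complex.I : n → ℂ)) := by
    ext i
    rw [Finset.sum_apply, Finset.sum_eq_single i]
    · simp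
    · intro k _ hk; simp [hk.symm]
    · simp
  conv_lhs => rw [h]
  simp

/-- The antilinear part of the real differential is the pairing with the Wirtinger gradient. -/
theorem star_dotProduct_wirtingerConj {n : Type*} [Fintype n] [DecidableEq n]
    (C : (n → ℂ) → ℂ) (f v : n → ℂ) :
    star v ⬝ᵥ wirtingerConj C f =
      (1 / 2) * (fderiv ℝ C f v + Complex.I * fderiv ℝ C f (Complex.I • v)) := by
  rw [clm_apply_eq_sum_single _ v, clm_apply_eq_sum_single _ (Complex.I • v), dotProduct,
    Finset.mul_sum, ← Finset.sum_add_distrib, Finset.mul_sum]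
  refine Finset.sum_congr rfl fun k _ => ?_
  have hv : star v k = (v k).re - (v k).im * Complex.I := by
    rw [Pi.star_apply, RCLike.star_def]
    apply Complex.ext <;> simp
  have h1 : ((Complex.I • v) k).re = -(v k).im := by simp
  have h2 : ((Complex.I • v) k).im = (v k).re := by simp
  rw [wirtingerConj, hv, h1, h2]
  push_cast
  linear_combination (-(1 / 2) * (v k).im * fderiv ℝ C f (Pi.single k Complex.I)) * Complex.I_mul_I

variable {M : ℕ} {C : (Fin M → ℂ) → ℂ} {f : Fin M → ℂ}

/-- The kernel of the differential is stable under i, so both terms of the antilinear part vanish on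
it. -/
theorem RegularConstraint.star_dotProduct_eq_zero (hC : RegularConstraint C f) {v : Fin M → ℂ}
    (hv : fderiv ℝ C f v = 0) : star v ⬝ᵥ wirtingerConj C f = 0 := by
  rw [star_dotProduct_wirtingerConj, hv, hC.tangent_complex v hv]; simp

/-- The pairing with the Wirtinger gradient, as a real-linear map. -/
noncomputable def gradPairing (q : Fin M → ℂ) : (Fin M → ℂ) →ₗ[ℝ] ℂ where
  toFun v := star v ⬝ᵥ q
  map_add' v w := by rw [star_add, add_dotProduct]
  map_smul' c v := by rw [star_smul, smul_dotProduct]; simp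

theorem gradPairing_surjective {q : Fin M → ℂ} (hq : q ≠ 0) :
    Function.Surjective (gradPairing q) := by
  obtain ⟨k, hk⟩ := Function.ne_iff.1 hq
  intro z
  refine ⟨Pi.single k (conj (z / q k)), ?_⟩
  change star _ ⬝ᵥ q = z
  rw [← Pi.single_star, single_dotProduct]
  simpa using div_mul_cancel₀ z hk

/-- A real dimension count. The kernel of the differential lies in that of the gradient pairing,
whose rank is 2; the rank of the differential is thus at least 2, and at most 2 because the target
is ℂ. -/
theorem RegularConstraint.ker_and_range (hC : RegularConstraint C f)
    (hq : wirtingerConj C f ≠ 0) :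
    LinearMap.ker (fderiv ℝ C f : (Fin M → ℂ) →ₗ[ℝ] ℂ) =
      LinearMap.ker (gradPairing (wirtingerConj C f)) ∧
    LinearMap.range (fderiv ℝ C f : (Fin M → ℂ) →ₗ[ℝ] ℂ) = ⊤ := by
  set D : (Fin M → ℂ) →ₗ[ℝ] ℂ := (fderiv ℝ C f : (Fin M → ℂ) →ₗ[ℝ] ℂ) with hD
  set Eq := gradPairing (wirtingerConj C f) with hE
  have hle : LinearMap.ker D ≤ LinearMap.ker Eq := fun v hv => hC.star_dotProduct_eq_zero hv
  have h1 := LinearMap.finrank_range_add_finrank_ker D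
  have h2 := LinearMap.finrank_range_add_finrank_ker Eq
  rw [LinearMap.range_eq_top.2 (gradPairing_surjective hq), finrank_top] at h2
  have h3 := Submodule.finrank_mono hle
  have h4 := Submodule.finrank_le (LinearMap.range D)
  exact ⟨Submodule.eq_of_le_of_finrank_le hle (by omega),
    Submodule.eq_top_of_finrank_eq (by omega)⟩

theorem RegularConstraint.fderiv_eq_zero_iff (hC : RegularConstraint C f)
    (hq : wirtingerConj C f ≠ 0) (v : Fin M → ℂ) :
    fderiv ℝ C f v = 0 ↔ colProjPerp (replicateCol Unit (wirtingerConj C f)) *ᵥ v = v := by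
  have h : fderiv ℝ C f v = 0 ↔ star v ⬝ᵥ wirtingerConj C f = 0 :=
    SetLike.ext_iff.1 (hC.ker_and_range hq).1 v
  rw [h, colProjPerp_mulVec_eq_self_iff]
  have e : ∀ u, ((replicateCol Unit (wirtingerConj C f))ᴴ *ᵥ v) u =
      star (star v ⬝ᵥ wirtingerConj C f) := by
    intro u
    simp [mulVec, dotProduct, mul_comm]
  constructor
  · intro h0; ext u; rw [e, h0, star_zero]; rfl
  · intro h0
    have := e ()
    rw [h0] at this
    exact star_eq_zero.1 this.symm

/-- Every tangent direction of a regular constraint is the velocity of a curve in the constraint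
set. -/
theorem RegularConstraint.exists_curve (hC : RegularConstraint C f) (hq : wirtingerConj C f ≠ 0)
    {u : Fin M → ℂ} (hu : fderiv ℝ C f u = 0) :
    ∃ γ : ℝ → Fin M → ℂ, γ 0 = f ∧ HasDerivAt γ u 0 ∧ ∀ᶠ t in 𝓝 0, C (γ t) = 0 := by
  have hs : HasStrictFDerivAt C (fderiv ℝ C f) f := hC.contDiffAt.hasStrictFDerivAt one_ne_zero
  have hr := (hC.ker_and_range hq).2
  -- The curve is the image of the straight line t ↦ tu in the kernel under the implicit function of
  -- `C`, whose derivative at 0 is the inclusion of the kernel.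
  let κ : ℝ → LinearMap.ker (fderiv ℝ C f : (Fin M → ℂ) →ₗ[ℝ] ℂ) := fun t => t • ⟨u, hu⟩
  have hκ0 : κ 0 = 0 := zero_smul _ _
  have hκ : HasDerivAt κ ⟨u, hu⟩ 0 := by
    simpa [κ] using (hasDerivAt_id (0 : ℝ)).smul_const
      (⟨u, hu⟩ : LinearMap.ker (fderiv ℝ C f : (Fin M → ℂ) →ₗ[ℝ] ℂ))
  refine ⟨fun t => hs.implicitFunction C _ hr (C f) (κ t), ?_, ?_, ?_⟩
  · simp [hκ0]
  · have h1 := (hs.to_implicitFunction hr).hasFDerivAt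
    rw [← hκ0] at h1
    exact h1.comp_hasDerivAt 0 hκ
  · have h1 := hs.map_implicitFunction_eq hr
    have hc : Filter.Tendsto (fun t => (C f, κ t)) (𝓝 0) (𝓝 (C f, 0)) := by
      have := hκ.continuousAt.tendsto
      rw [hκ0] at this
      exact tendsto_const_nhds.prodMk_nhds this
    filter_upwards [hc.eventually h1] with t ht
    rw [ht, hC.zero]

end Constraint

/-! ### Tightness of the bound -/

section Tightness

variable {M G : ℕ} {grp : Fin M → Fin G} {L : Fin G → ℕ}
  {P : ∀ i, Matrix (AntGroup grp i) (Fin (L i)) ℂ} {σ : ℝ} {f : Fin M → ℂ} {h : ChanIdx grp → ℂ}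
  {C : (Fin M → ℂ) → ℂ} {est : (ObsIdx grp L → ℂ) → Fin M → ℂ}

theorem modelLaw_calLik (θ : Fin M ⊕ ChanIdx grp → ℂ) :
    modelLaw volume (calLik σ P) θ = cgaussLaw σ (calMean P θ) := rfl

theorem LocallyUnbiased.memLp_cgaussLaw (he : LocallyUnbiased σ P f h C est) (k : Fin M) :
    MemLp (fun y => est y k) 2 (cgaussLaw σ (calMean P (Sum.elim f h))) := he.memLp k

/-- The mean of a locally unbiased estimator follows every tangent direction to first order. -/
theorem LocallyUnbiased.integral_linScore_smul (he : LocallyUnbiased σ P f h C est) (hσ : 0 < σ)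
    (hC : RegularConstraint C f) (hq : wirtingerConj C f ≠ 0) {v : Fin M ⊕ ChanIdx grp → ℂ}
    (hv : fderiv ℝ C f (v ∘ Sum.inl) = 0) (k : Fin M) :
    ∫ y, linScore σ (calMean P (Sum.elim f h)) (calJac P f h *ᵥ v) y • est y k
      ∂(cgaussLaw σ (calMean P (Sum.elim f h))) = v (Sum.inl k) := by
  obtain ⟨γ, hγ0, hγ, hγC⟩ := hC.exists_curve hq hv
  -- The nuisance parameter is unconstrained, so it may move along a straight line.
  let θ : ℝ → Fin M ⊕ ChanIdx grp → ℂ := fun t => Sum.elim (γ t) (h + t • (v ∘ Sum.inr))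
  have hθ0 : θ 0 = Sum.elim f h := by simp [θ, hγ0]
  have hθ : HasDerivAt θ v 0 := by
    rw [hasDerivAt_pi] at hγ ⊢
    rintro (i | i)
    · exact hγ i
    · have := ((hasDerivAt_id (0 : ℝ)).smul_const (v (Sum.inr i))).const_add (h i)
      rw [one_smul] at this
      exact this
  obtain ⟨Dm, hDm, hDmv⟩ := hasFDerivAt_calMean P f h
  obtain ⟨De, hDe, hDev⟩ := hasFDerivAt_integral_cgaussLaw _ hσ (he.memLp_cgaussLaw k)
  have h1 : HasDerivAt (fun t => ∫ y, est y k ∂(cgaussLaw σ (calMean P (θ t)))) (De (Dm v)) 0 := by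
    rw [← hθ0] at hDm hDe
    exact (hDe.comp (θ 0) hDm).comp_hasDerivAt (0 : ℝ) hθ
  have hin : Filter.Tendsto θ (𝓝 0)
      (𝓝[{θ' | C (θ' ∘ Sum.inl) = 0}] (Sum.elim f h)) := by
    refine tendsto_nhdsWithin_iff.2 ⟨?_, hγC⟩
    rw [← hθ0]; exact hθ.continuousAt.tendsto
  have h2 := he.unbiased.comp_tendsto hin
  have h3 : (fun t => θ t - Sum.elim f h) =O[𝓝 0] fun t : ℝ => t := by
    have := hθ.isBigO_sub
    simpa [hθ0] using this
  have h4 := h2.trans_isBigO h3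
  have h5 : (fun t => (∫ y, est y k ∂(cgaussLaw σ (calMean P (θ t)))) - γ t k)
      =o[𝓝 0] fun t : ℝ => t := isLittleO_pi.1 h4 k
  -- Evaluating the little-o bound at t = 0 itself gives exact unbiasedness at the true parameter.
  have h6 : (∫ y, est y k ∂(cgaussLaw σ (calMean P (θ 0)))) - γ 0 k = 0 := by
    have := (h5.def one_pos).self_of_nhds
    simpa using this
  have h7 : HasDerivAt (fun t => (∫ y, est y k ∂(cgaussLaw σ (calMean P (θ t)))) - γ t k) 0 0 := by
    rw [hasDerivAt_iff_isLittleO, h6]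
    simpa using h5
  have h8 := h7.unique (h1.sub ((hasDerivAt_pi.1 hγ) k))
  rw [← hDmv, ← hDev]
  exact (sub_eq_zero.1 h8.symm).trans rfl

/-- Real differentiation along v sees only the real part of the noise form; along iv it sees the
imaginary part. Both directions are admissible because the tangent space is complex. -/
theorem LocallyUnbiased.integral_mul_conj (he : LocallyUnbiased σ P f h C est) (hσ : 0 < σ)
    (hC : RegularConstraint C f) (hq : wirtingerConj C f ≠ 0) {v : Fin M ⊕ ChanIdx grp → ℂ}
    (hv : fderiv ℝ C f (v ∘ Sum.inl) = 0) (k : Fin M) :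
    ∫ y, est y k * conj (star (calJac P f h *ᵥ v) ⬝ᵥ (y - calMean P (Sum.elim f h)))
      ∂(cgaussLaw σ (calMean P (Sum.elim f h))) = (σ : ℂ) ^ 2 * v (Sum.inl k) := by
  have hσ' : (σ : ℂ) ≠ 0 := by exact_mod_cast hσ.ne'
  have hIv : fderiv ℝ C f ((Complex.I • v) ∘ Sum.inl) = 0 := hC.tangent_complex _ hv
  have h1 := he.integral_linScore_smul hσ hC hq hv k
  have h2 := he.integral_linScore_smul hσ hC hq hIv k
  have hm := he.memLp_cgaussLaw k
  have i1 := integrable_real_smul (memLp_linScore _ hσ (calJac P f h *ᵥ v)) hm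
  have i2 := integrable_real_smul (memLp_linScore _ hσ (calJac P f h *ᵥ (Complex.I • v))) hm
  have e : ∀ y, est y k * conj (star (calJac P f h *ᵥ v) ⬝ᵥ (y - calMean P (Sum.elim f h))) =
      ((σ : ℂ) ^ 2 / 2) *
        (linScore σ (calMean P (Sum.elim f h)) (calJac P f h *ᵥ v) y • est y k -
          Complex.I * (linScore σ (calMean P (Sum.elim f h))
            (calJac P f h *ᵥ (Complex.I • v)) y • est y k)) := by
    intro y
    have hI : (star (calJac P f h *ᵥ (Complex.I • v)) ⬝ᵥ
        (y - calMean P (Sum.elim f h))).re =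
        (star (calJac P f h *ᵥ v) ⬝ᵥ (y - calMean P (Sum.elim f h))).im := by
      rw [mulVec_smul, star_smul, smul_dotProduct]; simp
    simp only [linScore, hI]
    set z := star (calJac P f h *ᵥ v) ⬝ᵥ (y - calMean P (Sum.elim f h))
    have hz : conj z = z.re - z.im * Complex.I := by
      apply Complex.ext <;> simp
    rw [hz, Complex.real_smul, Complex.real_smul]
    push_cast
    field_simp
  simp only [e]
  rw [integral_const_mul, integral_sub i1 (i2.const_mul _), integral_const_mul, h1, h2,
    Pi.smul_apply, smul_eq_mul]
  linear_combination (-(σ : ℂ) ^ 2 / 2 * v (Sum.inl k)) * Complex.I_mul_I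

/-- Second moment matrices are positive semidefinite. -/
theorem posSemidef_secondMoment {Ω n : Type*} [Fintype n] [MeasurableSpace Ω] {ν : Measure Ω}
    {x : n → Ω → ℂ} (hx : ∀ k, MemLp (x k) 2 ν) :
    (Matrix.of fun k l => ∫ y, x k y * conj (x l y) ∂ν).PosSemidef := by
  refine PosSemidef.of_dotProduct_mulVec_nonneg ?_ fun c => ?_
  · ext k l
    simp only [conjTranspose_apply, of_apply, RCLike.star_def, ← integral_conj, map_mul,
      Complex.conj_conj, mul_comm]
  · have h1 : star c ⬝ᵥ ((Matrix.of fun k l => ∫ y, x k y * conj (x l y) ∂ν) *ᵥ c) =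
        ∫ y, ((‖∑ k, conj (c k) * x k y‖ ^ 2 : ℝ) : ℂ) ∂ν := by
      have e : ∀ y, ((‖∑ k, conj (c k) * x k y‖ ^ 2 : ℝ) : ℂ) =
          ∑ k, ∑ l, conj (c k) * c l * (x k y * conj (x l y)) := by
        intro y
        rw [Complex.ofReal_pow, ← Complex.mul_conj', map_sum, Finset.sum_mul_sum]
        refine Finset.sum_congr rfl fun k _ => Finset.sum_congr rfl fun l _ => ?_
        rw [map_mul, Complex.conj_conj]; ring
      have hi : ∀ k l, Integrable (fun y => conj (c k) * c l * (x k y * conj (x l y))) ν :=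
        fun k l => Integrable.const_mul ((hx k).integrable_mul (hx l).star) _
      simp only [e]
      rw [integral_finsetSum _ fun k _ => integrable_finsetSum _ fun l _ => hi k l]
      simp only [dotProduct, mulVec, of_apply, Pi.star_apply, RCLike.star_def, Finset.mul_sum]
      refine Finset.sum_congr rfl fun k _ => ?_
      rw [integral_finsetSum _ fun l _ => hi k l]
      refine Finset.sum_congr rfl fun l _ => ?_
      rw [integral_const_mul]; ring
    rw [h1, integral_complex_ofReal]
    exact_mod_cast integral_nonneg fun y => by positivity

/-- The estimator attaining the bound. -/
noncomputable def optimalEst (P : ∀ i, Matrix (AntGroup grp i) (Fin (L i)) ℂ) (f : Fin M → ℂ)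
    (h : ChanIdx grp → ℂ) (W : Matrix (Fin M) (Fin M) ℂ) (y : ObsIdx grp L → ℂ) : Fin M → ℂ :=
  f + (W * (calH P h)ᴴ * colProjPerp (calF P f)) *ᵥ (y - calMean P (Sum.elim f h))

theorem integral_optimalEst (hσ : 0 < σ) (W : Matrix (Fin M) (Fin M) ℂ)
    (θ : Fin M ⊕ ChanIdx grp → ℂ) :
    (fun k => ∫ y, optimalEst P f h W y k ∂(cgaussLaw σ (calMean P θ))) =
      f + (W * (calH P h)ᴴ * colProjPerp (calF P f)) *ᵥ
        (calMean P θ - calMean P (Sum.elim f h)) := by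
  have : Fact (0 < σ) := ⟨hσ⟩
  ext k
  set T := W * (calH P h)ᴴ * colProjPerp (calF P f) with hT
  have e : ∀ y, optimalEst P f h W y k = T k ⬝ᵥ (y - calMean P θ) +
      (f + T *ᵥ (calMean P θ - calMean P (Sum.elim f h))) k := by
    intro y
    simp only [optimalEst, ← hT, Pi.add_apply, mulVec, dotProduct_sub]
    ring
  simp only [e]
  rw [integral_add ((memLp_dotProduct_noise _ hσ _).integrable one_le_two) (integrable_const _),
    integral_dotProduct_noise _ hσ, integral_const]
  simp

variable {W Q : Matrix (Fin M) (Fin M) ℂ}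

/-- T𝓕 = 0 removes the first-order effect of the nuisance parameter, and T𝓗 = WK is the identity on
tangent directions. Displacements within the constraint set are tangent up to o(‖θ' - θ‖), so the
remaining bias is of that order. -/
theorem optimalEst_locallyUnbiased (hσ : 0 < σ) (hC : RegularConstraint C f)
    (hq : wirtingerConj C f ≠ 0)
    (hQ : Q = colProjPerp (replicateCol Unit (wirtingerConj C f)))
    (hKQ : W * calGram P f h * Q = Q) :
    LocallyUnbiased σ P f h C (optimalEst P f h W) := by
  have : Fact (0 < σ) := ⟨hσ⟩
  set T := W * (calH P h)ᴴ * colProjPerp (calF P f) with hT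
  refine ⟨fun k => ?_, ?_⟩
  · rw [modelLaw_calLik]
    exact (memLp_const (f k)).add (memLp_dotProduct_noise _ hσ (T k))
  simp only [modelLaw_calLik]
  simp only [integral_optimalEst hσ W, ← hT]
  set S := {θ' : Fin M ⊕ ChanIdx grp → ℂ | C (θ' ∘ Sum.inl) = 0}
  set θ := Sum.elim f h with hθ
  have hTF : T * calF P f = 0 := by rw [hT, Matrix.mul_assoc, colProjPerp_mul, Matrix.mul_zero]
  have hTH : T * calH P h = W * calGram P f h := by
    rw [hT, calGram]; simp only [Matrix.mul_assoc]
  obtain ⟨Dm, hDm, hDmv⟩ := hasFDerivAt_calMean P f h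
  -- the linearization error of the mean
  have r1 : (fun θ' => T *ᵥ (calMean P θ' - calMean P θ - calJac P f h *ᵥ (θ' - θ)))
      =o[𝓝[S] θ] fun θ' => θ' - θ := by
    have h1 := (hasFDerivAt_iff_isLittleO.1 hDm).mono (nhdsWithin_le_nhds (s := S))
    simp only [hDmv] at h1
    exact (ContinuousLinearMap.isBigO_comp T.mulVecLin.toContinuousLinearMap _ _).trans_isLittleO h1
  -- the constraint holds to first order
  have r2 : (fun θ' => fderiv ℝ C f ((θ' - θ) ∘ Sum.inl)) =o[𝓝[S] θ] fun θ' => θ' - θ := by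
    let pl : (Fin M ⊕ ChanIdx grp → ℂ) →L[ℝ] (Fin M → ℂ) :=
      (LinearMap.funLeft ℝ ℂ Sum.inl).toContinuousLinearMap
    have h1 : HasFDerivAt (fun θ' : Fin M ⊕ ChanIdx grp → ℂ => C (θ' ∘ Sum.inl))
        ((fderiv ℝ C f).comp pl) θ :=
      HasFDerivAt.comp (g := C) (f := pl) _
        (hC.contDiffAt.differentiableAt one_ne_zero).hasFDerivAt pl.hasFDerivAt
    have h2 := ((hasFDerivAt_iff_isLittleO.1 h1).mono (nhdsWithin_le_nhds (s := S))).neg_left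
    refine h2.congr' ?_ Filter.EventuallyEq.rfl
    filter_upwards [self_mem_nhdsWithin] with θ' hθ'
    have e1 : C (θ' ∘ Sum.inl) = 0 := hθ'
    have e2 : C (θ ∘ Sum.inl) = 0 := hC.zero
    rw [e1, e2]
    simp only [sub_zero, zero_sub, neg_neg]
    rfl
  have r3 : (fun θ' => (T * calH P h - 1) *ᵥ ((θ' - θ) ∘ Sum.inl)) =o[𝓝[S] θ]
      fun θ' => θ' - θ := by
    obtain ⟨R, hR⟩ := LinearMap.exists_rightInverse_of_surjective
      (fderiv ℝ C f : (Fin M → ℂ) →ₗ[ℝ] ℂ) (hC.ker_and_range hq).2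
    -- T𝓗 - 1 vanishes on the kernel of the differential, so it sees v only through dC(v), which
    -- `r2` shows to be small.
    have hN : ∀ v, (T * calH P h - 1) *ᵥ v = (T * calH P h - 1) *ᵥ R (fderiv ℝ C f v) := by
      intro v
      have hk : fderiv ℝ C f (v - R (fderiv ℝ C f v)) = 0 := by
        have := LinearMap.congr_fun hR (fderiv ℝ C f v)
        rw [map_sub, sub_eq_zero]
        exact this.symm
      rw [hC.fderiv_eq_zero_iff hq, ← hQ] at hk
      have h0 : (T * calH P h - 1) * Q = 0 := by
        rw [Matrix.sub_mul, hTH, hKQ, Matrix.one_mul, sub_self]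
      have : (T * calH P h - 1) *ᵥ (v - R (fderiv ℝ C f v)) = 0 := by
        rw [← hk, mulVec_mulVec, h0, zero_mulVec]
      rwa [mulVec_sub, sub_eq_zero] at this
    let N : ℂ →ₗ[ℝ] (Fin M → ℂ) :=
      ((T * calH P h - 1).mulVecLin.restrictScalars ℝ).comp R
    exact ((ContinuousLinearMap.isBigO_comp N.toContinuousLinearMap _ _).trans_isLittleO
      r2).congr_left fun θ' => (hN _).symm
  refine (r1.add r3).congr_left fun θ' => ?_
  rw [mulVec_sub, calJac_mulVec, mulVec_add, mulVec_mulVec, mulVec_mulVec, hTF, zero_mulVec,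
    sub_mulVec, one_mulVec]
  have : (θ' - θ) ∘ Sum.inl = θ' ∘ Sum.inl - f := rfl
  rw [this]
  abel

/-- Idempotence of P_𝓕^⊥ collapses TTᴴ to WKW, which is W because WKQ = Q and QW = W. -/
theorem optimalEst_gram (hW : Wᴴ = W) (hQW : Q * W = W) (hKQ : W * calGram P f h * Q = Q) :
    W * (calH P h)ᴴ * colProjPerp (calF P f) *
      (W * (calH P h)ᴴ * colProjPerp (calF P f))ᴴ = W := by
  have h1 : W * (calH P h)ᴴ * colProjPerp (calF P f) *
      (W * (calH P h)ᴴ * colProjPerp (calF P f))ᴴ = W * calGram P f h * W := by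
    simp only [conjTranspose_mul, conjTranspose_conjTranspose, hW, colProjPerp_conjTranspose,
      calGram, Matrix.mul_assoc]
    rw [← Matrix.mul_assoc (colProjPerp (calF P f)) (colProjPerp (calF P f)),
      colProjPerp_mul_colProjPerp]
  rw [h1]
  nth_rw 2 [← hQW]
  rw [← Matrix.mul_assoc, hKQ, hQW]

theorem integral_optimal_mul_conj (hσ : 0 < σ) (hW : Wᴴ = W) (hQW : Q * W = W)
    (hKQ : W * calGram P f h * Q = Q) (k l : Fin M) :
    ∫ y, (optimalEst P f h W y k - f k) * conj (optimalEst P f h W y l - f l)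
      ∂(cgaussLaw σ (calMean P (Sum.elim f h))) = (σ : ℂ) ^ 2 * W k l := by
  set T := W * (calH P h)ᴴ * colProjPerp (calF P f) with hT
  have e : ∀ y k, optimalEst P f h W y k - f k = T k ⬝ᵥ (y - calMean P (Sum.elim f h)) := by
    intro y k
    simp [optimalEst, ← hT, mulVec]
  simp only [e]
  rw [integral_dotProduct_noise_mul_conj _ hσ]
  congr 1
  exact congrFun (congrFun (optimalEst_gram hW hQW hKQ) k) l

theorem errorCov_optimalEst (hσ : 0 < σ) (hW : Wᴴ = W) (hQW : Q * W = W)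
    (hKQ : W * calGram P f h * Q = Q) :
    errorCov σ P f h (optimalEst P f h W) = ((σ ^ 2 : ℝ) : ℂ) • W := by
  ext k l
  rw [errorCov, of_apply, modelLaw_calLik, integral_optimal_mul_conj hσ hW hQW hKQ]
  simp

/-- The optimal error is a noise form along a tangent direction, so its correlation with an
admissible estimator is dictated by unbiasedness alone and does not depend on the estimator. -/
theorem LocallyUnbiased.integral_error_mul_conj_optimal (he : LocallyUnbiased σ P f h C est)
    (hσ : 0 < σ) (hC : RegularConstraint C f) (hq : wirtingerConj C f ≠ 0)
    (hQ : Q = colProjPerp (replicateCol Unit (wirtingerConj C f)))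
    (hW : Wᴴ = W) (hQW : Q * W = W) (k l : Fin M) :
    ∫ y, (est y k - f k) * conj (optimalEst P f h W y l - f l)
      ∂(cgaussLaw σ (calMean P (Sum.elim f h))) = (σ : ℂ) ^ 2 * W k l := by
  have : Fact (0 < σ) := ⟨hσ⟩
  set T := W * (calH P h)ᴴ * colProjPerp (calF P f) with hT
  -- The least favourable direction: the nuisance part is chosen so that the Jacobian sends v to
  -- P_𝓕^⊥𝓗 applied to column `l` of W.
  let v : Fin M ⊕ ChanIdx grp → ℂ := Sum.elim (W.col l) (-(pinv (calF P f) * (calH P h * W)).col l)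
  have hv : fderiv ℝ C f (v ∘ Sum.inl) = 0 := by
    rw [hC.fderiv_eq_zero_iff hq, ← hQ]
    exact congrArg (fun A : Matrix (Fin M) (Fin M) ℂ => A.col l) hQW
  have hTv : T l = star (calJac P f h *ᵥ v) := by
    have h1 : Tᴴ = calH P h * W - calF P f * (pinv (calF P f) * (calH P h * W)) := by
      rw [← colProjPerp_mul_eq, hT]
      simp only [conjTranspose_mul, conjTranspose_conjTranspose, hW, colProjPerp_conjTranspose]
    have h2 : calJac P f h *ᵥ v = Tᴴ.col l := by
      rw [calJac_mulVec, h1]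
      simp only [v, Sum.elim_comp_inl, Sum.elim_comp_inr, mulVec_neg, ← sub_eq_add_neg]
      rfl
    rw [h2]
    ext i
    simp
  have e : ∀ y, optimalEst P f h W y l - f l =
      star (calJac P f h *ᵥ v) ⬝ᵥ (y - calMean P (Sum.elim f h)) := by
    intro y
    rw [← hTv]
    simp [optimalEst, ← hT, mulVec]
  have hn := memLp_dotProduct_noise (calMean P (Sum.elim f h)) hσ (star (calJac P f h *ᵥ v))
  have i1 : Integrable (fun y => est y k *
      conj (star (calJac P f h *ᵥ v) ⬝ᵥ (y - calMean P (Sum.elim f h))))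
      (cgaussLaw σ (calMean P (Sum.elim f h))) := (he.memLp_cgaussLaw k).integrable_mul hn.star
  have i2 : Integrable (fun y => f k *
      conj (star (calJac P f h *ᵥ v) ⬝ᵥ (y - calMean P (Sum.elim f h))))
      (cgaussLaw σ (calMean P (Sum.elim f h))) :=
    Integrable.const_mul (hn.star.integrable one_le_two) _
  simp only [e, sub_mul]
  rw [integral_sub i1 i2, he.integral_mul_conj hσ hC hq hv, integral_const_mul, integral_conj,
    integral_dotProduct_noise _ hσ]
  simp [v]

theorem LocallyUnbiased.errorCov_sub_posSemidef (he : LocallyUnbiased σ P f h C est)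
    (hσ : 0 < σ) (hC : RegularConstraint C f) (hq : wirtingerConj C f ≠ 0)
    (hQ : Q = colProjPerp (replicateCol Unit (wirtingerConj C f)))
    (hW : Wᴴ = W) (hQW : Q * W = W) (hKQ : W * calGram P f h * Q = Q) :
    (errorCov σ P f h est - ((σ ^ 2 : ℝ) : ℂ) • W).PosSemidef := by
  have : Fact (0 < σ) := ⟨hσ⟩
  set ν := cgaussLaw σ (calMean P (Sum.elim f h)) with hν
  have hd : ∀ k, MemLp (fun y => est y k - f k) 2 ν := fun k =>
    (he.memLp_cgaussLaw k).sub (memLp_const _)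
  have ht : ∀ k, MemLp (fun y => optimalEst P f h W y k - f k) 2 ν := fun k =>
    ((optimalEst_locallyUnbiased hσ hC hq hQ hKQ).memLp_cgaussLaw k).sub (memLp_const _)
  -- Pythagoras: both cross terms and the optimal covariance equal σ²W, so the second moment of the
  -- difference is exactly the excess over the bound.
  have hps := posSemidef_secondMoment fun k => (hd k).sub (ht k)
  convert hps using 1
  ext k l
  have c1 := he.integral_error_mul_conj_optimal hσ hC hq hQ hW hQW k l
  have c2 := he.integral_error_mul_conj_optimal hσ hC hq hQ hW hQW l k
  have c3 := integral_optimal_mul_conj (P := P) (f := f) (h := h) hσ hW hQW hKQ k l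
  have c2' : ∫ y, (optimalEst P f h W y k - f k) * conj (est y l - f l) ∂ν =
      (σ : ℂ) ^ 2 * W k l := by
    have hWkl : conj (W l k) = W k l := congrFun (congrFun hW k) l
    have := congrArg conj c2
    rw [← integral_conj, map_mul, hWkl] at this
    simpa [mul_comm] using this
  have j1 : Integrable (fun y => (est y k - f k) * conj (est y l - f l)) ν :=
    (hd k).integrable_mul (hd l).star
  have j2 : Integrable (fun y => (est y k - f k) * conj (optimalEst P f h W y l - f l)) ν :=
    (hd k).integrable_mul (ht l).star
  have j3 : Integrable (fun y => (optimalEst P f h W y k - f k) * conj (est y l - f l)) ν :=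
    (ht k).integrable_mul (hd l).star
  have j4 : Integrable (fun y => (optimalEst P f h W y k - f k) *
      conj (optimalEst P f h W y l - f l)) ν := (ht k).integrable_mul (ht l).star
  have e : ∀ y, ((est y k - f k) - (optimalEst P f h W y k - f k)) *
      conj ((est y l - f l) - (optimalEst P f h W y l - f l)) =
      ((est y k - f k) * conj (est y l - f l) -
        (est y k - f k) * conj (optimalEst P f h W y l - f l)) -
      ((optimalEst P f h W y k - f k) * conj (est y l - f l) -
        (optimalEst P f h W y k - f k) * conj (optimalEst P f h W y l - f l)) := by
    intro y; rw [map_sub conj (est y l - f l)]; ring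
  simp only [of_apply, Pi.sub_apply, e]
  have j12 : Integrable (fun y => (est y k - f k) * conj (est y l - f l) -
      (est y k - f k) * conj (optimalEst P f h W y l - f l)) ν := j1.sub j2
  have j34 : Integrable (fun y => (optimalEst P f h W y k - f k) * conj (est y l - f l) -
      (optimalEst P f h W y k - f k) * conj (optimalEst P f h W y l - f l)) ν := j3.sub j4
  rw [integral_sub j12 j34, integral_sub j1 j2, integral_sub j3 j4, c1, c2', c3, errorCov,
    Matrix.sub_apply, of_apply, modelLaw_calLik, Matrix.smul_apply, smul_eq_mul]
  push_cast
  ring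

theorem isTightBound (hσ : 0 < σ) (hC : RegularConstraint C f) (hq : wirtingerConj C f ≠ 0)
    (hQ : Q = colProjPerp (replicateCol Unit (wirtingerConj C f)))
    (hW : Wᴴ = W) (hWQ : W * Q = W) (hKQ : W * calGram P f h * Q = Q) :
    IsTightBound σ P f h C (((σ ^ 2 : ℝ) : ℂ) • W) := by
  have hQW : Q * W = W := by
    have := congrArg Matrix.conjTranspose hWQ
    rwa [conjTranspose_mul, hQ, hW, colProjPerp_conjTranspose, ← hQ] at this
  exact ⟨fun est he => he.errorCov_sub_posSemidef hσ hC hq hQ hW hQW hKQ,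
    optimalEst P f h W, optimalEst_locallyUnbiased hσ hC hq hQ hKQ,
    errorCov_optimalEst hσ hW hQW hKQ⟩

end Tightness

/-! ### Compression matrices and identifiability -/

section Identifiability

/-- A left inverse of K on the range of Q agrees with a right inverse, the latter being the adjoint
of the equation for `W`. This identifies the compressed inverse with the pseudo-inverse. -/
theorem compressed_inverse_unique {n : Type*} [Fintype n] {K Q W W' : Matrix n n ℂ} (hK : Kᴴ = K)
    (hQ : Qᴴ = Q) (hW : Wᴴ = W) (hWQ : W * Q = W) (hWQ' : W' * Q = W')
    (hKQ : W * K * Q = Q) (hKQ' : W' * K * Q = Q) : W' = W := by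
  have hQW : Q * W = W := by
    have := congrArg Matrix.conjTranspose hWQ
    rwa [conjTranspose_mul, hQ, hW] at this
  have hQK : Q * (K * W) = Q := by
    have := congrArg Matrix.conjTranspose hKQ
    rwa [conjTranspose_mul, conjTranspose_mul, hQ, hW, hK] at this
  calc W' = W' * (Q * (K * W)) := by rw [hQK, hWQ']
    _ = W' * K * Q * W := by rw [← Matrix.mul_assoc, hWQ', Matrix.mul_assoc _ Q, hQW,
        Matrix.mul_assoc]
    _ = W := by rw [hKQ', hQW]

variable {M : ℕ} {q : Fin M → ℂ} {V : Matrix (Fin M) (Fin (M - 1)) ℂ}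

/-- With zero gradient the M - 1 columns of `V` would have to span everything; with truncated
subtraction this is possible only for M = 0. -/
theorem eq_zero_of_colProj_eq_perp_zero
    (hV : colProj V = colProjPerp (replicateCol Unit (0 : Fin M → ℂ))) : M = 0 := by
  have h1 : V * pinv V = 1 := by
    rw [mul_pinv, hV, colProjPerp, colProj]
    simp
  have h2 : (1 : Matrix (Fin M) (Fin M) ℂ).rank ≤ M - 1 := by
    rw [← h1]; exact (rank_mul_le_left _ _).trans (rank_le_width V)
  rw [rank_one, Fintype.card_fin] at h2
  omega

/-- Adjoining q to `V` gives a matrix with a right inverse and, since M - 1 + 1 = M, as many columns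
as rows. The right inverse is then two-sided, and its first block says that the columns of `V` are
independent. -/
theorem pinv_mul_of_colProj_eq_perp (hq : q ≠ 0)
    (hV : colProj V = colProjPerp (replicateCol Unit q)) : pinv V * V = 1 := by
  have hM : M ≠ 0 := by
    rintro rfl; exact hq (Subsingleton.elim _ _)
  have h1 : fromCols V (replicateCol Unit q) * fromRows (pinv V) (pinv (replicateCol Unit q)) = 1 := by
    rw [fromCols_mul_fromRows, mul_pinv, mul_pinv, hV, colProjPerp, sub_add_cancel]
  let e : Fin M ≃ Fin (M - 1) ⊕ Unit := Fintype.equivOfCardEq (by simp; omega)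
  have h2 := (mul_eq_one_comm_of_equiv e).1 h1
  rw [fromRows_mul_fromCols, ← fromBlocks_one] at h2
  exact (fromBlocks_inj.1 h2).1

theorem isUnit_compression (hq : q ≠ 0) (hV : colProj V = colProjPerp (replicateCol Unit q))
    {K W : Matrix (Fin M) (Fin M) ℂ} (hKW : K * W = colProjPerp (replicateCol Unit q))
    (hQW : colProjPerp (replicateCol Unit q) * W = W) :
    IsUnit (Vᴴ * K * V) := by
  have hl := pinv_mul_of_colProj_eq_perp hq hV
  -- The inverse is `W` written in the coordinates given by the columns of `V`.
  refine IsUnit.of_mul_eq_one (pinv V * W * (pinv V)ᴴ) ?_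
  calc Vᴴ * K * V * (pinv V * W * (pinv V)ᴴ)
      = Vᴴ * (K * ((V * pinv V) * W)) * (pinv V)ᴴ := by simp only [Matrix.mul_assoc]
    _ = Vᴴ * (pinv V)ᴴ := by rw [mul_pinv, hV, hQW, hKW, ← hV, conjTranspose_mul_colProj]
    _ = 1 := by rw [← conjTranspose_mul, hl, conjTranspose_one]

/-- 1 - K†K is Hermitian, fixes q and has its columns in the kernel ℂq, so it is the projection onto
that line. -/
theorem pinv_mul_self_of_ker {n : Type*} [Fintype n] [DecidableEq n] {K : Matrix n n ℂ}
    {q : n → ℂ} (hker : LinearMap.ker K.mulVecLin = Submodule.span ℂ {q}) :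
    pinv K * K = colProjPerp (replicateCol Unit q) := by
  have hK := pinv_spec K
  have hcol : ∀ j, ∃ c : ℂ, c • q = (1 - pinv K * K).col j := by
    intro j
    rw [← Submodule.mem_span_singleton, ← hker, LinearMap.mem_ker, mulVecLin_apply]
    have : K * (1 - pinv K * K) = 0 := by
      rw [Matrix.mul_sub, Matrix.mul_one, ← Matrix.mul_assoc, hK.mul_mul, sub_self]
    exact congrArg (fun A : Matrix n n ℂ => A.col j) this
  choose c hc using hcol
  have hq : K *ᵥ q = 0 := by
    have : q ∈ LinearMap.ker K.mulVecLin := hker ▸ Submodule.mem_span_singleton_self q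
    simpa using this
  have h := eq_colProj (X := replicateCol Unit q) (Q := 1 - pinv K * K)
    (Y := replicateRow Unit c) ?_ ?_ ?_
  · rw [colProjPerp, ← h, sub_sub_cancel]
  · rw [conjTranspose_sub, conjTranspose_one, hK.right_herm]
  · have : K * replicateCol Unit q = 0 := by
      rw [← replicateCol_mulVec, hq]; rfl
    rw [Matrix.sub_mul, Matrix.mul_assoc, this, Matrix.mul_zero, sub_zero, Matrix.one_mul]
  · ext i j
    have := congrFun (hc j) i
    rw [Matrix.col_apply] at this
    rw [← this]
    simp [mul_apply, mul_comm]

variable {G : ℕ} {grp : Fin M → Fin G} {L : Fin G → ℕ}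
  (P : ∀ i, Matrix (AntGroup grp i) (Fin (L i)) ℂ)

/-- 𝓗f = 𝓕h lies in the column space of 𝓕, which P_𝓕^⊥ kills: f is determined at best up to a scale
factor that h can absorb. -/
theorem calGram_mulVec_self (f : Fin M → ℂ) (h : ChanIdx grp → ℂ) : calGram P f h *ᵥ f = 0 := by
  rw [calGram, ← mulVec_mulVec, calH_mulVec, mulVec_mulVec, Matrix.mul_assoc, colProjPerp_mul,
    Matrix.mul_zero, zero_mulVec]

theorem ker_calGram {f : Fin M → ℂ} {h : ChanIdx grp → ℂ} (hf : f ≠ 0)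
    (h1 : Module.finrank ℂ (LinearMap.ker (calGram P f h).mulVecLin) = 1) :
    LinearMap.ker (calGram P f h).mulVecLin = Submodule.span ℂ {f} := by
  refine (Submodule.eq_of_le_of_finrank_eq ?_ ?_).symm
  · rw [Submodule.span_singleton_le_iff_mem]
    exact calGram_mulVec_self P f h
  · rw [finrank_span_singleton hf, h1]

theorem isTightBound_of_isEmpty {grp : Fin 0 → Fin G} {L : Fin G → ℕ}
    (P : ∀ i, Matrix (AntGroup grp i) (Fin (L i)) ℂ) (σ : ℝ) (f : Fin 0 → ℂ)
    (h : ChanIdx grp → ℂ) (C : (Fin 0 → ℂ) → ℂ) (B : Matrix (Fin 0) (Fin 0) ℂ) :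
    IsTightBound σ P f h C B := by
  refine ⟨fun est _ => ?_, fun _ => 0, ⟨fun k => k.elim0, ?_⟩, Subsingleton.elim _ _⟩
  · rw [Subsingleton.elim (errorCov σ P f h est - B) 0]
    exact PosSemidef.zero
  · refine (isLittleO_zero _ _).congr_left fun θ' => Subsingleton.elim _ _

end Identifiability

/-! ### The two standard constraints -/

section StandardConstraints

variable {M : ℕ}

/-- The real differential of the norm-plus-phase constraint. -/
noncomputable def normPhaseDeriv (f : Fin M → ℂ) : (Fin M → ℂ) →ₗ[ℝ] ℂ where
  toFun v := ⟨2 * (star f ⬝ᵥ v).re, (star v ⬝ᵥ f).im⟩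
  map_add' v w := by
    apply Complex.ext <;> simp [dotProduct_add, add_dotProduct, mul_add]
  map_smul' c v := by
    apply Complex.ext <;> simp [dotProduct_smul, smul_dotProduct, star_smul, mul_left_comm]

theorem star_dotProduct_comm {n : Type*} [Fintype n] (v f : n → ℂ) :
    star v ⬝ᵥ f = conj (star f ⬝ᵥ v) := by
  simp [dotProduct, mul_comm]

theorem normPhaseConstraint_eq (f v : Fin M → ℂ) :
    normPhaseConstraint f v = (((∑ k, ‖v k‖ ^ 2) - ∑ k, ‖f k‖ ^ 2 : ℝ) : ℂ) +
      (((star v ⬝ᵥ f).im : ℝ) : ℂ) * Complex.I := by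
  rw [normPhaseConstraint, Complex.mk_eq_add_mul_I]

theorem contDiff_normPhaseConstraint (f : Fin M → ℂ) : ContDiff ℝ 1 (normPhaseConstraint f) := by
  have h : normPhaseConstraint f = fun v => (((∑ k, ‖v k‖ ^ 2) - ∑ k, ‖f k‖ ^ 2 : ℝ) : ℂ) +
      (((star v ⬝ᵥ f).im : ℝ) : ℂ) * Complex.I := funext (normPhaseConstraint_eq f)
  rw [h]
  have hk : ∀ k : Fin M, ContDiff ℝ 1 fun v : Fin M → ℂ => v k := fun k => contDiff_apply ℝ ℂ k
  refine ContDiff.add (Complex.ofRealCLM.contDiff.comp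
    ((ContDiff.sum fun k _ => (hk k).norm_sq ℝ).sub contDiff_const)) (ContDiff.mul ?_ contDiff_const)
  exact Complex.ofRealCLM.contDiff.comp (Complex.imCLM.contDiff.comp
    (ContDiff.sum fun k _ => (Complex.conjCLE.contDiff.comp (hk k)).mul contDiff_const))

/-- The phase part is already real-linear, and the remainder of the norm part is exactly ∑ ‖v k‖².
-/
theorem hasFDerivAt_normPhaseConstraint (f : Fin M → ℂ) :
    HasFDerivAt (normPhaseConstraint f) (normPhaseDeriv f).toContinuousLinearMap f := by
  rw [hasFDerivAt_iff_isLittleO_nhds_zero]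
  refine (Complex.isLittleO_ofReal_left.2 (isLittleO_sum_norm_sq (ι := Fin M))).congr_left
    fun v => ?_
  have h1 : ∑ k, ‖(f + v) k‖ ^ 2 =
      ∑ k, ‖f k‖ ^ 2 + 2 * (star f ⬝ᵥ v).re + ∑ k, ‖v k‖ ^ 2 := by
    have := sum_norm_sub_sq f (-v)
    rw [star_neg, neg_dotProduct, star_dotProduct_comm v f] at this
    simpa using this
  change _ = (⟨(∑ k, ‖(f + v) k‖ ^ 2) - ∑ k, ‖f k‖ ^ 2, (star (f + v) ⬝ᵥ f).im⟩ : ℂ) -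
    ⟨(∑ k, ‖f k‖ ^ 2) - ∑ k, ‖f k‖ ^ 2, (star f ⬝ᵥ f).im⟩ -
    ⟨2 * (star f ⬝ᵥ v).re, (star v ⬝ᵥ f).im⟩
  rw [h1, star_add, add_dotProduct]
  apply Complex.ext
  · rw [Complex.sub_re, Complex.sub_re, Complex.ofReal_re]; ring
  · rw [Complex.sub_im, Complex.sub_im, Complex.ofReal_im, Complex.add_im]; ring

/-- The two real tangency conditions are the vanishing of the real and imaginary parts of fᴴv,
together the complex equation fᴴv = 0. -/
theorem regular_normPhase {f : Fin M → ℂ} : RegularConstraint (normPhaseConstraint f) f where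
  zero := by
    have : (star f ⬝ᵥ f).im = 0 := by
      simp [dotProduct, Complex.conj_mul', ← Complex.ofReal_pow]
    rw [normPhaseConstraint, sub_self, this]; rfl
  contDiffAt := (contDiff_normPhaseConstraint f).contDiffAt
  tangent_complex := by
    intro v
    rw [(hasFDerivAt_normPhaseConstraint f).fderiv]
    intro hv
    have h1 : 2 * (star f ⬝ᵥ v).re = 0 := congrArg Complex.re hv
    have h2 : (star v ⬝ᵥ f).im = 0 := congrArg Complex.im hv
    rw [star_dotProduct_comm, Complex.conj_im] at h2
    have h3 : star f ⬝ᵥ v = 0 := Complex.ext (by simpa using h1) (by simpa using h2)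
    change (⟨2 * (star f ⬝ᵥ (Complex.I • v)).re, (star (Complex.I • v) ⬝ᵥ f).im⟩ : ℂ) = 0
    rw [star_dotProduct_comm (Complex.I • v), dotProduct_smul, h3]
    simp; rfl

/-- The squared norm contributes f. The phase term i Im(w), w = f̂ᴴf, equals (w - w̄)/2, of which
only w depends on f̂*; it contributes f/2. -/
theorem wirtingerConj_normPhase (f : Fin M → ℂ) :
    wirtingerConj (normPhaseConstraint f) f = (3 / 2 : ℂ) • f := by
  ext k
  rw [wirtingerConj_eq (hasFDerivAt_normPhaseConstraint f)]
  change (1 / 2 : ℂ) * ((⟨2 * (star f ⬝ᵥ Pi.single k 1).re, (star (Pi.single k 1) ⬝ᵥ f).im⟩ : ℂ) +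
    Complex.I * ⟨2 * (star f ⬝ᵥ Pi.single k Complex.I).re,
      (star (Pi.single k Complex.I) ⬝ᵥ f).im⟩) = _
  apply Complex.ext <;> simp <;> ring

theorem span_smul_eq {c : ℂ} (hc : c ≠ 0) (f : Fin M → ℂ) :
    Submodule.span ℂ {c • f} = Submodule.span ℂ {f} :=
  Submodule.span_singleton_smul_eq hc.isUnit f

theorem hasFDerivAt_linearConstraint (g : Fin M → ℂ) (c : ℂ) (f : Fin M → ℂ) :
    HasFDerivAt (linearConstraint g c) (gradPairing g).toContinuousLinearMap f :=
  (gradPairing g).toContinuousLinearMap.hasFDerivAt.sub_const c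

theorem regular_linearConstraint (f : Fin M → ℂ) :
    RegularConstraint (linearConstraint f ((∑ k, ‖f k‖ ^ 2 : ℝ) : ℂ)) f where
  zero := by
    simp [linearConstraint, dotProduct, Complex.conj_mul']
  contDiffAt := by
    exact ((gradPairing f).toContinuousLinearMap.contDiff.sub contDiff_const).contDiffAt
  tangent_complex := by
    intro v
    rw [(hasFDerivAt_linearConstraint _ _ _).fderiv]
    intro hv
    have hv' : star v ⬝ᵥ f = 0 := hv
    change star (Complex.I • v) ⬝ᵥ f = 0
    rw [star_smul, smul_dotProduct, hv', smul_zero]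

theorem wirtingerConj_linearConstraint (f : Fin M → ℂ) (c : ℂ) :
    wirtingerConj (linearConstraint f c) f = f := by
  ext k
  rw [wirtingerConj_eq (hasFDerivAt_linearConstraint _ _ _)]
  change (1 / 2 : ℂ) * (star (Pi.single k 1) ⬝ᵥ f +
    Complex.I * star (Pi.single k Complex.I) ⬝ᵥ f) = _
  rw [← Pi.single_star, ← Pi.single_star, single_dotProduct, single_dotProduct]
  simp only [star_one, RCLike.star_def, Complex.conj_I]
  linear_combination (-(1 / 2) * f k) * Complex.I_mul_I

end StandardConstraints

/-! ### Cramér-Rao bounds for the calibration model -/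

theorem mainTheorem3 {M G : ℕ} (grp : Fin M → Fin G) (L : Fin G → ℕ)
    (P : ∀ i, Matrix (AntGroup grp i) (Fin (L i)) ℂ) (σ : ℝ) (hσ : 0 < σ)
    (f : Fin M → ℂ) (h : ChanIdx grp → ℂ) :
    -- the two forms of the bilinear model, and the Fisher information matrix
    (calH P h *ᵥ f = calF P f *ᵥ h) ∧
    (calFIM σ P f h = ((1 / σ ^ 2 : ℝ) : ℂ) •
      ((Matrix.fromCols (calH P h) (calF P f))ᴴ * Matrix.fromCols (calH P h) (calF P f))) ∧
    -- the constrained Cramér-Rao bound under a general complex constraint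
    (∀ (C : (Fin M → ℂ) → ℂ) (V : Matrix (Fin M) (Fin (M - 1)) ℂ),
      DifferentiableAt ℝ C f →
      colProj V = colProjPerp (replicateCol Unit (wirtingerConj C f)) →
      IsUnit (Vᴴ * calGram P f h * V) →
        calCRB σ P f h C = ((σ ^ 2 : ℝ) : ℂ) • (V * (Vᴴ * calGram P f h * V)⁻¹ * Vᴴ) ∧
        (RegularConstraint C f →
          IsTightBound σ P f h C
            (((σ ^ 2 : ℝ) : ℂ) • (V * (Vᴴ * calGram P f h * V)⁻¹ * Vᴴ)))) ∧
    -- constraints whose gradient spans the line of `f`, when `f` is identifiable up to scale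
    (f ≠ 0 → Module.finrank ℂ (LinearMap.ker (calGram P f h).mulVecLin) = 1 →
      LinearMap.ker (calGram P f h).mulVecLin = Submodule.span ℂ {f} ∧
      ∀ C : (Fin M → ℂ) → ℂ, DifferentiableAt ℝ C f →
        Submodule.span ℂ {wirtingerConj C f} = Submodule.span ℂ {f} →
          (∀ V : Matrix (Fin M) (Fin (M - 1)) ℂ,
            colProj V = colProjPerp (replicateCol Unit (wirtingerConj C f)) →
            IsUnit (Vᴴ * calGram P f h * V) ∧
            ((σ ^ 2 : ℝ) : ℂ) • (V * (Vᴴ * calGram P f h * V)⁻¹ * Vᴴ) =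
              ((σ ^ 2 : ℝ) : ℂ) • pinv (calGram P f h)) ∧
          calCRB σ P f h C = ((σ ^ 2 : ℝ) : ℂ) • pinv (calGram P f h) ∧
          (RegularConstraint C f →
            IsTightBound σ P f h C (((σ ^ 2 : ℝ) : ℂ) • pinv (calGram P f h)))) ∧
    -- the norm-plus-phase constraint and the linear constraint with `g = f` are of this kind
    (f ≠ 0 →
      (RegularConstraint (normPhaseConstraint f) f ∧
        Submodule.span ℂ {wirtingerConj (normPhaseConstraint f) f} = Submodule.span ℂ {f}) ∧
      (RegularConstraint (linearConstraint f ((∑ k, ‖f k‖ ^ 2 : ℝ) : ℂ)) f ∧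
        Submodule.span ℂ {wirtingerConj (linearConstraint f ((∑ k, ‖f k‖ ^ 2 : ℝ) : ℂ)) f} =
          Submodule.span ℂ {f})) := by
  have hσ2 : (0 : ℝ) < σ ^ 2 := by positivity
  refine ⟨calH_mulVec P h f, calFIM_eq P hσ f h, ?_, ?_, ?_⟩
  · intro C V hC hV hU
    obtain ⟨hW, hWQ, hKQ⟩ := compressed_inverse_spec (calGram_conjTranspose P f h) hU
    refine ⟨calCRB_eq P hσ hC hV hW hWQ hKQ, fun hreg => ?_⟩
    -- The tangent space argument needs a nonzero gradient; a zero gradient leaves only the trivial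
    -- case M = 0.
    by_cases hq : wirtingerConj C f = 0
    · rw [hq] at hV
      obtain rfl := eq_zero_of_colProj_eq_perp_zero hV
      exact isTightBound_of_isEmpty _ _ _ _ _ _
    · exact isTightBound hσ hreg hq hV hW hWQ hKQ
  · intro hf h1
    have hker := ker_calGram P hf h1
    refine ⟨hker, fun C hC hspan => ?_⟩
    have hK := calGram_conjTranspose P f h
    have hq : wirtingerConj C f ≠ 0 := by
      intro h0
      rw [h0, Submodule.span_zero_singleton, eq_comm, Submodule.span_singleton_eq_bot] at hspan
      exact hf hspan
    have hS := pinv_spec (calGram P f h)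
    -- The gradient spans the kernel of K, so K†K = Q, and K† can play the role of W below.
    have hQ := pinv_mul_self_of_ker (hker.trans hspan.symm)
    have hW : (pinv (calGram P f h))ᴴ = pinv (calGram P f h) := by
      rw [← pinv_conjTranspose, hK]
    have hKW : calGram P f h * pinv (calGram P f h) =
        colProjPerp (replicateCol Unit (wirtingerConj C f)) := by
      rw [← colProjPerp_conjTranspose, ← hQ, conjTranspose_mul, hK, hW]
    have hWQ : pinv (calGram P f h) * colProjPerp (replicateCol Unit (wirtingerConj C f)) =
        pinv (calGram P f h) := by
      rw [← hKW, ← Matrix.mul_assoc, hS.mul_mul']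
    have hQW : colProjPerp (replicateCol Unit (wirtingerConj C f)) * pinv (calGram P f h) =
        pinv (calGram P f h) := by
      rw [← hQ, hS.mul_mul']
    have hKQ : pinv (calGram P f h) * calGram P f h *
        colProjPerp (replicateCol Unit (wirtingerConj C f)) =
        colProjPerp (replicateCol Unit (wirtingerConj C f)) := by
      rw [hQ, colProjPerp_mul_colProjPerp]
    refine ⟨fun V hV => ?_, calCRB_eq P hσ hC rfl hW hWQ hKQ,
      fun hreg => isTightBound hσ hreg hq rfl hW hWQ hKQ⟩
    have hU := isUnit_compression hq hV hKW hQW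
    obtain ⟨-, hWQ', hKQ'⟩ := compressed_inverse_spec hK hU
    rw [hV] at hWQ' hKQ'
    exact ⟨hU, by rw [compressed_inverse_unique hK (colProjPerp_conjTranspose _) hW hWQ hWQ'
      hKQ hKQ']⟩
  · intro _
    refine ⟨⟨regular_normPhase, ?_⟩, regular_linearConstraint f, ?_⟩
    · rw [wirtingerConj_normPhase, span_smul_eq (by norm_num)]
    · rw [wirtingerConj_linearConstraint]
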